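/- Let $C$ be a commutative $\mathbb{C}$-algebra and let $A$ and $B$ be Azumaya algebras over $C$. Algebras are associative and unital, not necessarily commutative. For a commutative ring $K$, a $K$-algebra $E$ and a $K$-algebra $R$, let $R\ast_K E$ be the coproduct of $K$-algebras (the pushout of $R\leftarrow K\to E$ in rings), and let the root algebra $\sqrt[E]{R}=(R\ast_K E)^E$ be the centralizer of the image of $E$ in $R\ast_K E$ (the base $K$ is understood); it is a $K$-algebra, functorial in $R$. For a $\mathbb{C}$-algebra $S$ put $\sqrt[n]{S}=\sqrt[M_n(\mathbb{C})]{S}$, formed over $\mathbb{C}$. 1. There are isomorphisms of $C$-algebras $$\sqrt[A]{\sqrt[B]{R}}\;\simeq\;\sqrt[A\otimes_C B]{R}\;\simeq\;\sqrt[B]{\sqrt[A]{R}},$$ natural in the $C$-algebra $R$. They are the canonical ones: the first is the restriction of the map $\sqrt[B]{R}\ast_C A\to R\ast_C(A\otimes_C B)$ induced by $R\ast_C B\to R\ast_C(A\otimes_C B)$, $b\mapsto 1\otimes b$, and by $a\mapsto a\otimes 1$; the map from $\sqrt[B]{\sqrt[A]{R}}$ is obtained in the same way with the roles of $A$ and $B$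 exchanged. 2. For every commutative $C$-algebra $D$ there are isomorphisms of $D$-algebras $$\sqrt[A]{R}\otimes_C D\;\simeq\;\sqrt[A\otimes_C D]{R\otimes_C D}$$ (the right-hand side formed over $D$), natural in the $C$-algebra $R$. They are the canonical ones, induced by the map $R\ast_C A\to (R\otimes_C D)\ast_D(A\otimes_C D)$. 3. Suppose that $A$ is of constant degree $n$, i.e. of constant rank $n^2$ as a $C$-module. Then $\sqrt[A]{S\otimes_{\mathbb{C}} C}$ is, étale locally on $C$, isomorphic to $\sqrt[n]{S}\otimes_{\mathbb{C}} C$: there is a faithfully flat étale $C$-algebra $D$ such that, for every $\mathbb{C}$-algebra $S$, there is an isomorphism of $D$-algebras $$\sqrt[A]{S\otimes_{\mathbb{C}} C}\otimes_C D\;\simeq\;(\sqrt[n]{S}\otimes_{\mathbb{C}} C)\otimes_C D.$$ 4. Every $C$-algebra morphism $f\colon A\to B$ induces $C$-algebra morphisms $\psi_R\colon\sqrt[B]{R}\to\sqrt[A]{R}$, natural in the $C$-algebra $R$. Here, writing $\eta_A\colon R\to A\otimes_C\sqrt[A]{R}$ for the universal map, which corresponds to $R\to R\ast_C A$ under the multiplication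 map $A\otimes_C\sqrt[A]{R}\to R\ast_C A$ (and similarly $\eta_B$), $\psi_R$ is the unique $C$-algebra morphism with $(\mathrm{id}_B\otimes\psi_R)\circ\eta_B=(f\otimes\mathrm{id})\circ\eta_A$. -/

import Mathlib

open scoped TensorProduct

universe u v w x y z

noncomputable section

/-- The relations imposed on the tensor algebra of `R × A` to obtain the coproduct: the two
inclusions of `R` and `A` become unital and multiplicative. -/
inductive AlgCoprodRel (C : Type u) [CommRing C] (R : Type v) [Ring R] [Algebra C R]
    (A : Type w) [Ring A] [Algebra C A] :
    TensorAlgebra C (R × A) → TensorAlgebra C (R × A) → Prop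
  | inl_one : AlgCoprodRel C R A (TensorAlgebra.ι C ((1 : R), (0 : A))) 1
  | inr_one : AlgCoprodRel C R A (TensorAlgebra.ι C ((0 : R), (1 : A))) 1
  | inl_mul (r s : R) : AlgCoprodRel C R A (TensorAlgebra.ι C (r * s, (0 : A)))
      (TensorAlgebra.ι C (r, (0 : A)) * TensorAlgebra.ι C (s, (0 : A)))
  | inr_mul (a b : A) : AlgCoprodRel C R A (TensorAlgebra.ι C ((0 : R), a * b))
      (TensorAlgebra.ι C ((0 : R), a) * TensorAlgebra.ι C ((0 : R), b))

/-- The coproduct `R ∗_C A` of two (not necessarily commutative) `C`-algebras, i.e. the pushout of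
`R ← C → A` in the category of rings. -/
def AlgCoprod (C : Type u) [CommRing C] (R : Type v) [Ring R] [Algebra C R]
    (A : Type w) [Ring A] [Algebra C A] : Type (max u v w) :=
  RingQuot (AlgCoprodRel C R A)

namespace AlgCoprod

section

variable (C : Type u) [CommRing C] (R : Type v) [Ring R] [Algebra C R]
  (A : Type w) [Ring A] [Algebra C A]

instance : Ring (AlgCoprod C R A) := inferInstanceAs (Ring (RingQuot (AlgCoprodRel C R A)))

instance : Algebra C (AlgCoprod C R A) :=
  inferInstanceAs (Algebra C (RingQuot (AlgCoprodRel C R A)))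

/-- The quotient map from the tensor algebra. -/
def mk : TensorAlgebra C (R × A) →ₐ[C] AlgCoprod C R A :=
  RingQuot.mkAlgHom C (AlgCoprodRel C R A)

theorem mk_rel {p q : TensorAlgebra C (R × A)} (h : AlgCoprodRel C R A p q) :
    mk C R A p = mk C R A q :=
  RingQuot.mkAlgHom_rel C h

/-- The canonical map `R → R ∗_C A`. -/
def inl : R →ₐ[C] AlgCoprod C R A :=
  AlgHom.ofLinearMap
    ((mk C R A).toLinearMap ∘ₗ TensorAlgebra.ι C ∘ₗ LinearMap.inl C R A)
    ((mk_rel C R A AlgCoprodRel.inl_one).trans (map_one _))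
    (fun r s => (mk_rel C R A (AlgCoprodRel.inl_mul r s)).trans (map_mul _ _ _))

/-- The canonical map `A → R ∗_C A`. -/
def inr : A →ₐ[C] AlgCoprod C R A :=
  AlgHom.ofLinearMap
    ((mk C R A).toLinearMap ∘ₗ TensorAlgebra.ι C ∘ₗ LinearMap.inr C R A)
    ((mk_rel C R A AlgCoprodRel.inr_one).trans (map_one _))
    (fun a b => (mk_rel C R A (AlgCoprodRel.inr_mul a b)).trans (map_mul _ _ _))

variable {C R A}

/-- The map `R ∗_C A → T` with prescribed restrictions to `R` and to `A`. -/
def lift {T : Type x} [Ring T] [Algebra C T] (f : R →ₐ[C] T) (g : A →ₐ[C] T) :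
    AlgCoprod C R A →ₐ[C] T :=
  RingQuot.liftAlgHom C
    ⟨TensorAlgebra.lift C (f.toLinearMap.coprod g.toLinearMap), by
      intro p q h
      cases h <;> simp⟩

@[simp]
theorem lift_inl {T : Type x} [Ring T] [Algebra C T] (f : R →ₐ[C] T) (g : A →ₐ[C] T) (r : R) :
    lift f g (inl C R A r) = f r := by
  change RingQuot.liftAlgHom C _ (RingQuot.mkAlgHom C _ (TensorAlgebra.ι C (r, (0 : A)))) = f r
  rw [RingQuot.liftAlgHom_mkAlgHom_apply]
  simp

@[simp]
theorem lift_inr {T : Type x} [Ring T] [Algebra C T] (f : R →ₐ[C] T) (g : A →ₐ[C] T) (a : A) :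
    lift f g (inr C R A a) = g a := by
  change RingQuot.liftAlgHom C _ (RingQuot.mkAlgHom C _ (TensorAlgebra.ι C ((0 : R), a))) = g a
  rw [RingQuot.liftAlgHom_mkAlgHom_apply]
  simp

theorem hom_ext {T : Type x} [Ring T] [Algebra C T] {f g : AlgCoprod C R A →ₐ[C] T}
    (hl : ∀ r, f (inl C R A r) = g (inl C R A r))
    (hr : ∀ a, f (inr C R A a) = g (inr C R A a)) : f = g := by
  have key : f.comp (mk C R A) = g.comp (mk C R A) := by
    apply TensorAlgebra.hom_ext
    apply LinearMap.prod_ext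
    · ext r
      exact hl r
    · ext a
      exact hr a
  ext t
  obtain ⟨p, rfl⟩ := RingQuot.mkAlgHom_surjective C (AlgCoprodRel C R A) t
  exact AlgHom.congr_fun key p

/-- Functoriality of the coproduct in both arguments. -/
def map {R' : Type x} [Ring R'] [Algebra C R'] {A' : Type y} [Ring A'] [Algebra C A']
    (f : R →ₐ[C] R') (g : A →ₐ[C] A') : AlgCoprod C R A →ₐ[C] AlgCoprod C R' A' :=
  lift ((inl C R' A').comp f) ((inr C R' A').comp g)

/-- For a commutative `C`-algebra `D`, the canonical map
`R ∗_C A → (D ⊗_C R) ∗_D (D ⊗_C A)`, given on `R` by `r ↦ 1 ⊗ r` and on `A` by `a ↦ 1 ⊗ a`. -/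
def baseChange (D : Type x) [CommRing D] [Algebra C D] :
    AlgCoprod C R A →+* AlgCoprod D (D ⊗[C] R) (D ⊗[C] A) :=
  letI : Algebra C (AlgCoprod D (D ⊗[C] R) (D ⊗[C] A)) :=
    Algebra.compHom _ (algebraMap C D)
  haveI : IsScalarTower C D (AlgCoprod D (D ⊗[C] R) (D ⊗[C] A)) :=
    IsScalarTower.of_algebraMap_eq fun _ => rfl
  (lift
    (((inl D (D ⊗[C] R) (D ⊗[C] A)).restrictScalars C).comp
      (Algebra.TensorProduct.includeRight : R →ₐ[C] D ⊗[C] R))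
    (((inr D (D ⊗[C] R) (D ⊗[C] A)).restrictScalars C).comp
      (Algebra.TensorProduct.includeRight : A →ₐ[C] D ⊗[C] A))).toRingHom

end

end AlgCoprod

/-- The centralizer `(R ∗_C A)^A` of `A` in `R ∗_C A`, as a `C`-subalgebra. -/
def rootSubalgebra (C : Type u) [CommRing C] (A : Type w) [Ring A] [Algebra C A]
    (R : Type v) [Ring R] [Algebra C R] : Subalgebra C (AlgCoprod C R A) :=
  Subalgebra.centralizer C (Set.range (AlgCoprod.inr C R A))

/-- The `A`-th root algebra of the `C`-algebra `R`. -/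
abbrev RootAlgebra (C : Type u) [CommRing C] (A : Type w) [Ring A] [Algebra C A]
    (R : Type v) [Ring R] [Algebra C R] : Type (max u v w) :=
  rootSubalgebra C A R

/-- The `n`-th root algebra of a `ℂ`-algebra `S`: the centralizer of `M_n(ℂ)` in `S ∗ M_n(ℂ)`. -/
abbrev NthRootAlgebra (n : ℕ) (S : Type v) [Ring S] [Algebra ℂ S] : Type v :=
  RootAlgebra ℂ (Matrix (Fin n) (Fin n) ℂ) S

namespace RootAlgebra

section

variable {C : Type u} [CommRing C] {A : Type w} [Ring A] [Algebra C A]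
  {R : Type v} [Ring R] [Algebra C R]

/-- Functoriality of the root algebra in `R`: the restriction of `g ∗ id_A` to centralizers. -/
def map (A : Type w) [Ring A] [Algebra C A] {R' : Type x} [Ring R'] [Algebra C R']
    (g : R →ₐ[C] R') : RootAlgebra C A R →ₐ[C] RootAlgebra C A R' :=
  ((AlgCoprod.map g (AlgHom.id C A)).comp (rootSubalgebra C A R).val).codRestrict
    (rootSubalgebra C A R') (by
      rintro ⟨t, ht⟩
      refine (Subalgebra.mem_centralizer_iff C).2 ?_
      rintro _ ⟨a, rfl⟩
      have h := congrArg (AlgCoprod.map g (AlgHom.id C A))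
        ((Subalgebra.mem_centralizer_iff C).1 ht _ ⟨a, rfl⟩)
      simpa [AlgCoprod.map] using h)

/-- Given algebra maps `i : A → E` and `j : B → E`, the canonical map from
`RootAlgebra C B R ∗_C A` to `R ∗_C E`: on `RootAlgebra C B R ⊆ R ∗_C B` it is the restriction of
`id_R ∗ j`, and on `A` it is `i` followed by the inclusion of `E`. -/
def iterateMap {B : Type x} [Ring B] [Algebra C B] {E : Type y} [Ring E] [Algebra C E]
    (R : Type v) [Ring R] [Algebra C R] (i : A →ₐ[C] E) (j : B →ₐ[C] E) :
    AlgCoprod C (RootAlgebra C B R) A →ₐ[C] AlgCoprod C R E :=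
  AlgCoprod.lift
    ((AlgCoprod.map (AlgHom.id C R) j).comp (rootSubalgebra C B R).val)
    ((AlgCoprod.inr C R E).comp i)

variable (C A R) in
/-- The multiplication map `A ⊗_C (R ∗_C A)^A → R ∗_C A`, `a ⊗ t ↦ a t`. It is an isomorphism when
`A` is Azumaya over `C`. -/
def mulMap : A ⊗[C] RootAlgebra C A R →ₐ[C] AlgCoprod C R A :=
  Algebra.TensorProduct.lift (AlgCoprod.inr C R A) (rootSubalgebra C A R).val
    (fun a t => (Subalgebra.mem_centralizer_iff C).1 t.2 _ ⟨a, rfl⟩)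

/-- `η : R → A ⊗_C RootAlgebra C A R` is the universal map (the unit of the adjunction between
the root algebra and `A ⊗_C -`): it corresponds to the canonical map `R → R ∗_C A` under the
multiplication map `A ⊗_C RootAlgebra C A R → R ∗_C A`. -/
def IsUniversalMap (η : R →ₐ[C] A ⊗[C] RootAlgebra C A R) : Prop :=
  ∀ r : R, mulMap C A R (η r) = AlgCoprod.inl C R A r

/-- `ψ : RootAlgebra C B R → RootAlgebra C A R` is induced by the algebra map `f : A → B`: it is the
map that corresponds, under the universal property of `RootAlgebra C B R`, to the composite
`R → A ⊗_C RootAlgebra C A R → B ⊗_C RootAlgebra C A R` of the universal map for `A` with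
`f ⊗ id`. -/
def IsInducedBy {B : Type x} [Ring B] [Algebra C B] (f : A →ₐ[C] B)
    (ψ : RootAlgebra C B R →ₐ[C] RootAlgebra C A R) : Prop :=
  ∃ (ηA : R →ₐ[C] A ⊗[C] RootAlgebra C A R) (ηB : R →ₐ[C] B ⊗[C] RootAlgebra C B R),
    IsUniversalMap ηA ∧ IsUniversalMap ηB ∧
      (Algebra.TensorProduct.map (AlgHom.id C B) ψ).comp ηB =
        (Algebra.TensorProduct.map f (AlgHom.id C (RootAlgebra C A R))).comp ηA

end

end RootAlgebra

end

/-!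
If `A` is Azumaya over `C`, then `A ⊗ Aᵐᵒᵖ ≃ End A` makes every `C`-algebra `T` under `A` the tensor
product of `A` with the centralizer `T^A`. So `R ∗ A ≃ A ⊗ RootAlgebra C A R`, and the root algebra
is left adjoint to `A ⊗ -`: a map `A → B` acts on right adjoints, hence on root algebras.
Conversely, whenever commuting maps `A → T` and `S → T` induce `A ⊗ S ≃ T`, faithful flatness of `A`
identifies `S` with `T^A`; this gives the composition of roots and their base change.

Base change reduces the comparison with matrix roots to splitting `A` étale locally. At a geometric
point `A` becomes a matrix algebra, and there a separable characteristic polynomial provides a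
rank-one idempotent that is a polynomial in a single element. The element can be chosen with
coordinates that are roots of unity, and the idempotent comes from a coprime factorization, so both
lift to an étale neighbourhood. The left ideal generated by the idempotent is then the standard
representation, and finitely many such neighbourhoods cover the spectrum.
-/

noncomputable section

section Sandwich

variable {C : Type*} [CommRing C] {A : Type*} [Ring A] [Algebra C A]
  {T : Type*} [Ring T] [Algebra C T]

/-- The action of the enveloping algebra `A ⊗ Aᵐᵒᵖ` on an algebra `T` under `A`: the tensor
`p ⊗ op q` acts as `t ↦ φ p * t * φ q`. -/
def sandwich (φ : A →ₐ[C] T) : A ⊗[C] Aᵐᵒᵖ →ₐ[C] Module.End C T :=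
  (AlgHom.mulLeftRight C T).comp (Algebra.TensorProduct.map φ φ.op)

variable (φ : A →ₐ[C] T)

@[simp]
theorem sandwich_tmul (p : A) (q : Aᵐᵒᵖ) (t : T) :
    sandwich φ (p ⊗ₜ q) t = φ p * t * φ q.unop := by
  simp [sandwich]

theorem sandwich_mul_of_mem_centralizer {s : T}
    (hs : s ∈ Subalgebra.centralizer C (Set.range φ)) (τ : A ⊗[C] Aᵐᵒᵖ) (t : T) :
    sandwich φ τ (t * s) = sandwich φ τ t * s := by
  induction τ with
  | zero => simp
  | tmul p q =>
    have hq : φ q.unop * s = s * φ q.unop :=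
      (Subalgebra.mem_centralizer_iff C).1 hs _ ⟨q.unop, rfl⟩
    simp [mul_assoc, hq]
  | add τ τ' h h' => simp [add_mul, h, h']

theorem sandwich_apply_map (τ : A ⊗[C] Aᵐᵒᵖ) (x : A) :
    sandwich φ τ (φ x) = φ (AlgHom.mulLeftRight C A τ x) := by
  induction τ with
  | zero => simp
  | tmul p q => simp
  | add τ τ' h h' => simp [h, h']

end Sandwich

section Centralizer

variable (C : Type*) [CommRing C]

theorem exists_finite_dual_basis (M : Type*) [AddCommGroup M] [Module C M] [Module.Finite C M]
    [Module.Projective C M] :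
    ∃ (n : ℕ) (b : Fin n → M) (f : Fin n → M →ₗ[C] C), ∀ x, ∑ i, f i x • b i = x := by
  obtain ⟨n, g, f, -, -, hgf⟩ := Module.Finite.exists_comp_eq_id_of_projective C M
  refine ⟨n, fun i => g (Pi.single i 1), fun i => LinearMap.proj i ∘ₗ f, fun x => ?_⟩
  calc ∑ i, f x i • g (Pi.single i 1) = g (∑ i, f x i • Pi.single i 1) := by simp
    _ = g (f x) := by rw [← pi_eq_sum_univ']
    _ = x := LinearMap.congr_fun hgf x

theorem faithfullyFlat_of_faithfulSMul (M : Type*) [AddCommGroup M] [Module C M] [Module.Flat C M]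
    [Module.Finite C M] [FaithfulSMul C M] : Module.FaithfullyFlat C M where
  submodule_ne_top I hI h := by
    obtain ⟨r, hrI, hr⟩ := Submodule.exists_mem_and_smul_eq_self_of_fg_of_le_smul I ⊤
      (Module.Finite.fg_top (R := C) (M := M)) h.ge
    have hr_one : r = 1 := FaithfulSMul.eq_of_smul_eq_smul fun m : M => by
      rw [hr m trivial, one_smul]
    exact hI.ne_top ((Ideal.eq_top_iff_one I).2 (hr_one ▸ hrI))

variable {A : Type*} [Ring A] [Algebra C A]

/- The elements `e i` are the preimages of `x ↦ f i x • 1` under `A ⊗ Aᵐᵒᵖ ≃ End A`, for a dual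
basis `(b, f)` of `A`. -/
theorem exists_centralizing_dual_basis [IsAzumaya C A] :
    ∃ (n : ℕ) (b : Fin n → A) (f : Fin n → A →ₗ[C] C) (e : Fin n → A ⊗[C] Aᵐᵒᵖ),
      (∀ x, ∑ i, f i x • b i = x) ∧
      (∀ i x, AlgHom.mulLeftRight C A (e i) x = algebraMap C A (f i x)) ∧
      (∀ i x, (x ⊗ₜ 1) * e i = (1 ⊗ₜ MulOpposite.op x) * e i) ∧
      ∑ i, (b i ⊗ₜ 1) * e i = 1 := by
  obtain ⟨n, b, f, hbf⟩ := exists_finite_dual_basis C A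
  choose e he using fun i => (IsAzumaya.bij (R := C) (A := A)).2 (Algebra.linearMap C A ∘ₗ f i)
  have he_apply (i : Fin n) (x : A) :
      AlgHom.mulLeftRight C A (e i) x = algebraMap C A (f i x) := by rw [he]; rfl
  refine ⟨n, b, f, e, hbf, he_apply, fun i x => ?_, ?_⟩ <;>
    refine (IsAzumaya.bij (R := C) (A := A)).1 (LinearMap.ext fun y => ?_)
  · simp [he_apply, Algebra.commutes]
  · simpa [he_apply, ← Algebra.commutes, ← Algebra.smul_def] using hbf y

end Centralizer

section CentralizerMul

variable {C : Type*} [CommRing C] {A : Type*} [Ring A] [Algebra C A]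
  {T : Type*} [Ring T] [Algebra C T]

/-- The multiplication map from `A ⊗ T^A` to `T`, where `T^A` is the centralizer of the image
of `A` in `T`. -/
def centralizerMul (φ : A →ₐ[C] T) : A ⊗[C] Subalgebra.centralizer C (Set.range φ) →ₐ[C] T :=
  Algebra.TensorProduct.lift φ (Subalgebra.centralizer C (Set.range φ)).val
    (fun a t => (Subalgebra.mem_centralizer_iff C).1 t.2 _ ⟨a, rfl⟩)

@[simp]
theorem centralizerMul_tmul (φ : A →ₐ[C] T) (a : A)
    (t : Subalgebra.centralizer C (Set.range φ)) : centralizerMul φ (a ⊗ₜ t) = φ a * t :=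
  Algebra.TensorProduct.lift_tmul _ _ _ _ _

theorem centralizerMul_bijective [IsAzumaya C A] (φ : A →ₐ[C] T) :
    Function.Bijective (centralizerMul φ) := by
  obtain ⟨n, b, f, e, hbf, he_apply, he_comm, he_sum⟩ :=
    exists_centralizing_dual_basis C (A := A)
  have sandwich_mem (i : Fin n) (t : T) :
      sandwich φ (e i) t ∈ Subalgebra.centralizer C (Set.range φ) := by
    rw [Subalgebra.mem_centralizer_iff]
    rintro _ ⟨a, rfl⟩
    simpa using LinearMap.congr_fun (congrArg (sandwich φ) (he_comm i a)) t
  let proj (i : Fin n) : T →ₗ[C] Subalgebra.centralizer C (Set.range φ) :=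
    (sandwich φ (e i)).codRestrict (Subalgebra.toSubmodule (Subalgebra.centralizer C (Set.range φ)))
      (sandwich_mem i)
  have proj_apply (i : Fin n) (t : T) : (proj i t : T) = sandwich φ (e i) t := rfl
  let inv : T →ₗ[C] A ⊗[C] Subalgebra.centralizer C (Set.range φ) :=
    ∑ i, TensorProduct.mk C _ _ (b i) ∘ₗ proj i
  have inv_mul : inv ∘ₗ (centralizerMul φ).toLinearMap = LinearMap.id := by
    refine TensorProduct.ext' fun a s => ?_
    have proj_mul (i : Fin n) : proj i (φ a * s) = f i a • s := Subtype.ext <|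
      calc sandwich φ (e i) (φ a * s) = φ (algebraMap C A (f i a)) * s := by
            rw [sandwich_mul_of_mem_centralizer φ s.2, sandwich_apply_map, he_apply]
        _ = f i a • (s : T) := by rw [AlgHom.commutes, Algebra.smul_def]
    calc inv (centralizerMul φ (a ⊗ₜ s)) = (∑ i, f i a • b i) ⊗ₜ s := by
          simp [inv, proj_mul, TensorProduct.sum_tmul, TensorProduct.smul_tmul]
      _ = a ⊗ₜ s := by rw [hbf]
  have mul_inv (t : T) : centralizerMul φ (inv t) = t := by
    simpa [inv, proj_apply] using LinearMap.congr_fun (congrArg (sandwich φ) he_sum) t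
  exact Function.bijective_iff_has_inverse.2 ⟨inv, LinearMap.congr_fun inv_mul, mul_inv⟩

section Complement

variable {S : Type*} [Ring S] [Algebra C S] {i : A →ₐ[C] T} {g : S →ₐ[C] T}
  (hig : ∀ a s, Commute (i a) (g s))

include hig in
theorem injective_of_lift_injective [IsAzumaya C A]
    (h : Function.Injective (Algebra.TensorProduct.lift i g hig)) : Function.Injective g := by
  have := faithfullyFlat_of_faithfulSMul C A
  let mul : A ⊗[C] T →ₗ[C] T := LinearMap.mul' C T ∘ₗ i.toLinearMap.rTensor T
  have mul_comp : mul ∘ₗ g.toLinearMap.lTensor A =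
      (Algebra.TensorProduct.lift i g hig).toLinearMap := by
    ext
    simp [mul]
  refine (Module.FaithfullyFlat.lTensor_injective_iff_injective C A g.toLinearMap).1
    (Function.Injective.of_comp (f := mul) ?_)
  rwa [← LinearMap.coe_comp, mul_comp]

/- The map `A ⊗ S → T` factors through `A ⊗ T^A ≃ T`, so `A ⊗ S → A ⊗ T^A` is surjective. -/
theorem centralizer_range_eq_range_of_lift_surjective [IsAzumaya C A]
    (h : Function.Surjective (Algebra.TensorProduct.lift i g hig)) :
    Subalgebra.centralizer C (Set.range i) = g.range := by
  have := faithfullyFlat_of_faithfulSMul C A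
  have apply_mem (s : S) : g s ∈ Subalgebra.centralizer C (Set.range i) := by
    rw [Subalgebra.mem_centralizer_iff]
    rintro _ ⟨a, rfl⟩
    exact hig a s
  let ι := g.codRestrict _ apply_mem
  have mul_comp : (centralizerMul i).toLinearMap ∘ₗ ι.toLinearMap.lTensor A =
      (Algebra.TensorProduct.lift i g hig).toLinearMap := by
    ext
    simp [ι]
  have surjective_lTensor : Function.Surjective (ι.toLinearMap.lTensor A) :=
    Function.Surjective.of_comp_left (f := centralizerMul i)
      (by rwa [← AlgHom.coe_toLinearMap (centralizerMul i), ← LinearMap.coe_comp, mul_comp])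
      (centralizerMul_bijective i).1
  refine le_antisymm (fun z hz => ?_) (by rintro _ ⟨s, rfl⟩; exact apply_mem s)
  obtain ⟨s, hs⟩ := (Module.FaithfullyFlat.lTensor_surjective_iff_surjective C A
    ι.toLinearMap).1 surjective_lTensor ⟨z, hz⟩
  exact ⟨s, congrArg Subtype.val hs⟩

/-- If `i : A → T` and `g : S → T` have commuting images and induce `A ⊗ S ≃ T`, then `g`
identifies `S` with the centralizer of the image of `A`. -/
def centralizerEquiv [IsAzumaya C A]
    (h : Function.Bijective (Algebra.TensorProduct.lift i g hig)) :
    S ≃ₐ[C] Subalgebra.centralizer C (Set.range i) :=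
  (AlgEquiv.ofInjective g (injective_of_lift_injective hig h.1)).trans
    (Subalgebra.equivOfEq _ _ (centralizer_range_eq_range_of_lift_surjective hig h.2).symm)

end Complement

/- If `D → T` is injective then so is `D ⊗ A → T^A ⊗ A ≃ T`, because `A` is flat. -/
theorem lift_injective_of_algebraMap_injective [IsAzumaya C A] {D : Type*} [CommRing D]
    [Algebra C D] [Algebra D T] [IsScalarTower C D T] (φ : A →ₐ[C] T)
    (h : Function.Injective (algebraMap D T)) :
    Function.Injective (AlgHom.liftEquiv C D A T φ) := by
  have apply_mem (d : D) : algebraMap D T d ∈ Subalgebra.centralizer C (Set.range φ) := by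
    rw [Subalgebra.mem_centralizer_iff]
    rintro _ ⟨a, rfl⟩
    exact (Algebra.commutes d (φ a)).symm
  let ι := (IsScalarTower.toAlgHom C D T).codRestrict _ apply_mem
  have ι_apply (d : D) : (ι d : T) = algebraMap D T d := rfl
  have hι : Function.Injective ι := fun d d' hd => h (congrArg Subtype.val hd)
  have lift_eq (x : D ⊗[C] A) : AlgHom.liftEquiv C D A T φ x =
      centralizerMul φ (ι.toLinearMap.lTensor A (TensorProduct.comm C D A x)) := by
    induction x with
    | zero => simp
    | tmul d a => simp [ι_apply, Algebra.smul_def, Algebra.commutes]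
    | add x y hx hy => simp only [map_add, hx, hy]
  rw [funext lift_eq]
  exact (centralizerMul_bijective φ).1.comp <|
    (Module.Flat.lTensor_preserves_injective_linearMap ι.toLinearMap hι).comp
      (TensorProduct.comm C D A).injective

end CentralizerMul

namespace AlgCoprod

variable {C : Type*} [CommRing C] {R : Type*} [Ring R] [Algebra C R] {A : Type*} [Ring A]
  [Algebra C A] {R' : Type*} [Ring R'] [Algebra C R'] {A' : Type*} [Ring A'] [Algebra C A']

@[ext]
theorem algHom_ext {T : Type*} [Ring T] [Algebra C T] {f g : AlgCoprod C R A →ₐ[C] T}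
    (hl : f.comp (inl C R A) = g.comp (inl C R A))
    (hr : f.comp (inr C R A) = g.comp (inr C R A)) : f = g :=
  hom_ext (DFunLike.congr_fun hl) (DFunLike.congr_fun hr)

theorem range_lift_le {T : Type*} [Ring T] [Algebra C T] {f : R →ₐ[C] T} {g : A →ₐ[C] T}
    {S : Subalgebra C T} (hf : ∀ r, f r ∈ S) (hg : ∀ a, g a ∈ S) : (lift f g).range ≤ S := by
  have lift_eq : lift f g = S.val.comp (lift (f.codRestrict S hf) (g.codRestrict S hg)) :=
    hom_ext (by simp) (by simp)
  rintro _ ⟨t, rfl⟩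
  rw [lift_eq]
  exact (lift (f.codRestrict S hf) (g.codRestrict S hg) t).2

@[simp]
theorem map_inl (f : R →ₐ[C] R') (g : A →ₐ[C] A') (r : R) :
    map f g (inl C R A r) = inl C R' A' (f r) := by
  simp [map]

@[simp]
theorem map_inr (f : R →ₐ[C] R') (g : A →ₐ[C] A') (a : A) :
    map f g (inr C R A a) = inr C R' A' (g a) := by
  simp [map]

end AlgCoprod

namespace RootAlgebra

section Adjunction

variable {C : Type*} [CommRing C] {A : Type*} [Ring A] [Algebra C A] {R : Type*} [Ring R]
  [Algebra C R] {R' : Type*} [Ring R'] [Algebra C R'] {S : Type*} [Ring S] [Algebra C S]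

theorem mem_rootSubalgebra_iff {t : AlgCoprod C R A} :
    t ∈ rootSubalgebra C A R ↔ ∀ a, Commute (AlgCoprod.inr C R A a) t :=
  (Subalgebra.mem_centralizer_iff C).trans Set.forall_mem_range

theorem commute_inr_coe (a : A) (t : RootAlgebra C A R) :
    Commute (AlgCoprod.inr C R A a) (t : AlgCoprod C R A) :=
  mem_rootSubalgebra_iff.1 t.2 a

@[simp]
theorem mulMap_tmul (a : A) (t : RootAlgebra C A R) :
    mulMap C A R (a ⊗ₜ t) = AlgCoprod.inr C R A a * t :=
  Algebra.TensorProduct.lift_tmul _ _ _ _ _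

@[simp]
theorem coe_map (g : R →ₐ[C] R') (t : RootAlgebra C A R) :
    (map A g t : AlgCoprod C R' A) = AlgCoprod.map g (AlgHom.id C A) t :=
  rfl

theorem mulMap_map (g : R →ₐ[C] R') (t : A ⊗[C] RootAlgebra C A R) :
    mulMap C A R' (Algebra.TensorProduct.map (AlgHom.id C A) (map A g) t) =
      AlgCoprod.map g (AlgHom.id C A) (mulMap C A R t) := by
  induction t with
  | zero => simp
  | tmul a t => simp
  | add a b ha hb => simp only [_root_.map_add, ha, hb]

variable [IsAzumaya C A]

variable (C A R) in
theorem mulMap_bijective : Function.Bijective (mulMap C A R) :=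
  centralizerMul_bijective (AlgCoprod.inr C R A)

variable (C A R) in
/-- The multiplication map `A ⊗ RootAlgebra C A R → R ∗ A` as an isomorphism, for `A` Azumaya. -/
def mulEquiv : A ⊗[C] RootAlgebra C A R ≃ₐ[C] AlgCoprod C R A :=
  AlgEquiv.ofBijective (mulMap C A R) (mulMap_bijective C A R)

@[simp]
theorem mulEquiv_apply (t : A ⊗[C] RootAlgebra C A R) : mulEquiv C A R t = mulMap C A R t :=
  rfl

@[simp]
theorem mulEquiv_symm_inr (a : A) : (mulEquiv C A R).symm (AlgCoprod.inr C R A a) = a ⊗ₜ 1 := by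
  rw [AlgEquiv.symm_apply_eq]
  simp

@[simp]
theorem mulEquiv_symm_coe (t : RootAlgebra C A R) :
    (mulEquiv C A R).symm (t : AlgCoprod C R A) = 1 ⊗ₜ t := by
  rw [AlgEquiv.symm_apply_eq]
  simp

variable (C A R) in
/-- The universal map `η : R → A ⊗ RootAlgebra C A R`. -/
def unit : R →ₐ[C] A ⊗[C] RootAlgebra C A R :=
  (mulEquiv C A R).symm.toAlgHom.comp (AlgCoprod.inl C R A)

@[simp]
theorem mulMap_unit (r : R) : mulMap C A R (unit C A R r) = AlgCoprod.inl C R A r :=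
  (mulEquiv C A R).apply_symm_apply _

theorem isUniversalMap_iff_eq_unit {η : R →ₐ[C] A ⊗[C] RootAlgebra C A R} :
    IsUniversalMap η ↔ η = unit C A R := by
  refine ⟨fun h => AlgHom.ext fun r => ?_, by rintro rfl; exact mulMap_unit⟩
  exact (mulMap_bijective C A R).1 ((h r).trans (mulMap_unit r).symm)

theorem map_comp_unit (g : R →ₐ[C] R') :
    (Algebra.TensorProduct.map (AlgHom.id C A) (map A g)).comp (unit C A R) =
      (unit C A R').comp g :=
  AlgHom.ext fun r => (mulMap_bijective C A R').1 (by simp [mulMap_map])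

variable (C A S) in
/-- `S` is the centralizer of `A` in `A ⊗ S`. -/
def tensorCentralizerEquiv : S ≃ₐ[C] Subalgebra.centralizer C
    (Set.range (Algebra.TensorProduct.includeLeft : A →ₐ[C] A ⊗[C] S)) :=
  centralizerEquiv (g := Algebra.TensorProduct.includeRight)
    (fun a s => by simp [commute_iff_eq])
    (by rw [Algebra.TensorProduct.lift_includeLeft_includeRight]; exact Function.bijective_id)

theorem one_tmul_injective : Function.Injective fun s : S => (1 : A) ⊗ₜ[C] s :=
  Subtype.val_injective.comp (tensorCentralizerEquiv C A S).injective

/-- The map `RootAlgebra C A R → S` corresponding to `h : R → A ⊗ S`: the extension of `h` to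
`R ∗ A → A ⊗ S`, restricted to the centralizers of `A`. -/
def desc (h : R →ₐ[C] A ⊗[C] S) : RootAlgebra C A R →ₐ[C] S :=
  (tensorCentralizerEquiv C A S).symm.toAlgHom.comp <|
    ((AlgCoprod.lift h Algebra.TensorProduct.includeLeft).comp
      (rootSubalgebra C A R).val).codRestrict _ fun t => by
      rw [Subalgebra.mem_centralizer_iff]
      rintro _ ⟨a, rfl⟩
      simpa using
        ((commute_inr_coe a t).map (AlgCoprod.lift h Algebra.TensorProduct.includeLeft)).eq

theorem one_tmul_desc (h : R →ₐ[C] A ⊗[C] S) (t : RootAlgebra C A R) :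
    (1 : A) ⊗ₜ[C] desc h t =
      AlgCoprod.lift h Algebra.TensorProduct.includeLeft (t : AlgCoprod C R A) :=
  congrArg Subtype.val ((tensorCentralizerEquiv C A S).apply_symm_apply _)

theorem map_desc (h : R →ₐ[C] A ⊗[C] S) (t : A ⊗[C] RootAlgebra C A R) :
    Algebra.TensorProduct.map (AlgHom.id C A) (desc h) t =
      AlgCoprod.lift h Algebra.TensorProduct.includeLeft (mulMap C A R t) := by
  induction t with
  | zero => simp
  | add a b ha hb => simp only [_root_.map_add, ha, hb]
  | tmul a t =>
    rw [mulMap_tmul, map_mul, ← one_tmul_desc]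
    simp

theorem lift_map_comp_unit (φ : RootAlgebra C A R →ₐ[C] S) :
    AlgCoprod.lift ((Algebra.TensorProduct.map (AlgHom.id C A) φ).comp (unit C A R))
        Algebra.TensorProduct.includeLeft =
      (Algebra.TensorProduct.map (AlgHom.id C A) φ).comp (mulEquiv C A R).symm.toAlgHom :=
  AlgCoprod.hom_ext (by simp [unit]) (by simp)

/-- The adjunction between the `A`-th root algebra and `A ⊗ -`. -/
def homEquiv : (RootAlgebra C A R →ₐ[C] S) ≃ (R →ₐ[C] A ⊗[C] S) where
  toFun φ := (Algebra.TensorProduct.map (AlgHom.id C A) φ).comp (unit C A R)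
  invFun := desc
  left_inv φ := AlgHom.ext fun t => one_tmul_injective (C := C) (A := A) <| by
    simp [one_tmul_desc, lift_map_comp_unit]
  right_inv h := AlgHom.ext fun r => by simp [map_desc]

theorem homEquiv_apply (φ : RootAlgebra C A R →ₐ[C] S) :
    homEquiv φ = (Algebra.TensorProduct.map (AlgHom.id C A) φ).comp (unit C A R) :=
  rfl

theorem homEquiv_comp (φ : RootAlgebra C A R →ₐ[C] S) {S' : Type*} [Ring S'] [Algebra C S']
    (k : S →ₐ[C] S') :
    homEquiv (k.comp φ) = (Algebra.TensorProduct.map (AlgHom.id C A) k).comp (homEquiv φ) := by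
  rw [homEquiv_apply, Algebra.TensorProduct.map_id_comp, AlgHom.comp_assoc, homEquiv_apply]

theorem homEquiv_comp_map (φ : RootAlgebra C A R' →ₐ[C] S) (g : R →ₐ[C] R') :
    homEquiv (φ.comp (map A g)) = (homEquiv φ).comp g := by
  rw [homEquiv_comp, homEquiv_apply (map A g), map_comp_unit, homEquiv_apply, AlgHom.comp_assoc]

end Adjunction

section Induced

variable {C : Type*} [CommRing C] {A : Type*} [Ring A] [Algebra C A] [IsAzumaya C A] {B : Type*}
  [Ring B] [Algebra C B] [IsAzumaya C B] {R : Type*} [Ring R] [Algebra C R] {R' : Type*} [Ring R']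
  [Algebra C R']

variable (R) in
/-- The map of root algebras induced by a homomorphism `A → B`. -/
def induced (f : A →ₐ[C] B) : RootAlgebra C B R →ₐ[C] RootAlgebra C A R :=
  homEquiv.symm
    ((Algebra.TensorProduct.map f (AlgHom.id C (RootAlgebra C A R))).comp (unit C A R))

theorem homEquiv_induced (f : A →ₐ[C] B) :
    homEquiv (induced R f) =
      (Algebra.TensorProduct.map f (AlgHom.id C (RootAlgebra C A R))).comp (unit C A R) :=
  homEquiv.apply_symm_apply _

theorem isInducedBy_iff_eq_induced {f : A →ₐ[C] B}
    {φ : RootAlgebra C B R →ₐ[C] RootAlgebra C A R} : IsInducedBy f φ ↔ φ = induced R f := by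
  constructor
  · rintro ⟨ηA, ηB, hA, hB, h⟩
    rw [isUniversalMap_iff_eq_unit.1 hA, isUniversalMap_iff_eq_unit.1 hB] at h
    exact homEquiv.injective (h.trans (homEquiv_induced f).symm)
  · rintro rfl
    exact ⟨unit C A R, unit C B R, isUniversalMap_iff_eq_unit.2 rfl,
      isUniversalMap_iff_eq_unit.2 rfl, homEquiv_induced f⟩

theorem induced_comp_map (f : A →ₐ[C] B) (g : R →ₐ[C] R') :
    (induced R' f).comp (map B g) = (map A g).comp (induced R f) := by
  have map_comm : (Algebra.TensorProduct.map f (AlgHom.id C (RootAlgebra C A R'))).comp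
      (Algebra.TensorProduct.map (AlgHom.id C A) (map A g)) =
      (Algebra.TensorProduct.map (AlgHom.id C B) (map A g)).comp
        (Algebra.TensorProduct.map f (AlgHom.id C (RootAlgebra C A R))) := by
    ext <;> simp
  apply homEquiv.injective
  rw [homEquiv_comp_map, homEquiv_comp, homEquiv_induced, homEquiv_induced, AlgHom.comp_assoc,
    ← map_comp_unit, ← AlgHom.comp_assoc, map_comm, AlgHom.comp_assoc]

end Induced

end RootAlgebra

namespace RootAlgebra

section Iterate

variable {C : Type*} [CommRing C] {A : Type*} [Ring A] [Algebra C A] {B : Type*} [Ring B]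
  [Algebra C B] {E : Type*} [Ring E] [Algebra C E] {R : Type*} [Ring R] [Algebra C R]

@[simp]
theorem iterateMap_inl (i : A →ₐ[C] E) (j : B →ₐ[C] E) (t : RootAlgebra C B R) :
    iterateMap R i j (AlgCoprod.inl C _ A t) = AlgCoprod.map (AlgHom.id C R) j t := by
  simp [iterateMap]

@[simp]
theorem iterateMap_inr (i : A →ₐ[C] E) (j : B →ₐ[C] E) (a : A) :
    iterateMap R i j (AlgCoprod.inr C (RootAlgebra C B R) A a) = AlgCoprod.inr C R E (i a) := by
  simp [iterateMap]

theorem iterateMap_map {R' : Type*} [Ring R'] [Algebra C R'] (i : A →ₐ[C] E) (j : B →ₐ[C] E)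
    (g : R →ₐ[C] R') (w : AlgCoprod C (RootAlgebra C B R) A) :
    iterateMap R' i j (AlgCoprod.map (map B g) (AlgHom.id C A) w) =
      AlgCoprod.map g (AlgHom.id C E) (iterateMap R i j w) := by
  have map_comm : (AlgCoprod.map (AlgHom.id C R') j).comp (AlgCoprod.map g (AlgHom.id C B)) =
      (AlgCoprod.map g (AlgHom.id C E)).comp (AlgCoprod.map (AlgHom.id C R) j) :=
    AlgCoprod.hom_ext (by simp) (by simp)
  have iterateMap_comp : (iterateMap R' i j).comp (AlgCoprod.map (map B g) (AlgHom.id C A)) =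
      (AlgCoprod.map g (AlgHom.id C E)).comp (iterateMap R i j) :=
    AlgCoprod.hom_ext (fun t => by simpa using DFunLike.congr_fun map_comm (t : AlgCoprod C R B))
      (by simp)
  exact DFunLike.congr_fun iterateMap_comp w

variable {i : A →ₐ[C] E} {j : B →ₐ[C] E} (hij : ∀ a b, Commute (i a) (j b))

include hij in
theorem commute_inr_iterateMap (b : B) (w : AlgCoprod C (RootAlgebra C B R) A) :
    Commute (AlgCoprod.inr C R E (j b)) (iterateMap R i j w) := by
  refine (Subalgebra.mem_centralizer_iff C).1 (AlgCoprod.range_lift_le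
    (S := Subalgebra.centralizer C {AlgCoprod.inr C R E (j b)}) (fun t => ?_) (fun a => ?_)
    ⟨w, rfl⟩) _ rfl
  · simpa [Subalgebra.mem_centralizer_iff] using
      ((commute_inr_coe b t).map (AlgCoprod.map (AlgHom.id C R) j)).eq
  · simpa [Subalgebra.mem_centralizer_iff] using ((hij a b).symm.map (AlgCoprod.inr C R E)).eq

variable (R) in
/-- The multiplication map `B ⊗ (RootAlgebra C B R ∗ A) → R ∗ E`, for commuting algebra maps
`A → E` and `B → E`. -/
def mulIterateMap : B ⊗[C] AlgCoprod C (RootAlgebra C B R) A →ₐ[C] AlgCoprod C R E :=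
  Algebra.TensorProduct.lift ((AlgCoprod.inr C R E).comp j) (iterateMap R i j)
    (commute_inr_iterateMap hij)

@[simp]
theorem mulIterateMap_tmul (b : B) (w : AlgCoprod C (RootAlgebra C B R) A) :
    mulIterateMap R hij (b ⊗ₜ w) = AlgCoprod.inr C R E (j b) * iterateMap R i j w :=
  Algebra.TensorProduct.lift_tmul _ _ _ _ _

theorem mulIterateMap_map_inl (s : B ⊗[C] RootAlgebra C B R) :
    mulIterateMap R hij (Algebra.TensorProduct.map (AlgHom.id C B)
        (AlgCoprod.inl C (RootAlgebra C B R) A) s) =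
      AlgCoprod.map (AlgHom.id C R) j (mulMap C B R s) := by
  induction s with
  | zero => simp
  | add s s' hs hs' => simp only [_root_.map_add, hs, hs']
  | tmul b s => simp

theorem mulIterateMap_map_inr (s : A ⊗[C] B) :
    mulIterateMap R hij (Algebra.TensorProduct.map (AlgHom.id C B)
        (AlgCoprod.inr C (RootAlgebra C B R) A) (Algebra.TensorProduct.comm C A B s)) =
      AlgCoprod.inr C R E (Algebra.TensorProduct.lift i j hij s) := by
  induction s with
  | zero => simp
  | add s s' hs hs' => simp only [_root_.map_add, hs, hs']
  | tmul a b => simp [← (hij a b).eq, ← map_mul]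

variable (h : Function.Bijective (Algebra.TensorProduct.lift i j hij))

section Bijective

variable [IsAzumaya C B]

variable (R) in
/-- The inverse of `mulIterateMap`, when `A ⊗ B ≃ E`. -/
def mulIterateInv : AlgCoprod C R E →ₐ[C] B ⊗[C] AlgCoprod C (RootAlgebra C B R) A :=
  AlgCoprod.lift
    ((Algebra.TensorProduct.map (AlgHom.id C B) (AlgCoprod.inl C (RootAlgebra C B R) A)).comp
      (unit C B R))
    ((Algebra.TensorProduct.map (AlgHom.id C B) (AlgCoprod.inr C (RootAlgebra C B R) A)).comp
      ((Algebra.TensorProduct.comm C A B).toAlgHom.comp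
        (AlgEquiv.ofBijective _ h).symm.toAlgHom))

theorem mulIterateMap_mulIterateInv (t : AlgCoprod C R E) :
    mulIterateMap R hij (mulIterateInv R hij h t) = t := by
  have comp_eq : (mulIterateMap R hij).comp (mulIterateInv R hij h) = AlgHom.id C _ :=
    AlgCoprod.hom_ext (fun r => by simp [mulIterateInv, mulIterateMap_map_inl])
      (fun x => by
        obtain ⟨s, rfl⟩ := h.2 x
        simp [mulIterateInv, mulIterateMap_map_inr])
  exact DFunLike.congr_fun comp_eq t

theorem mulIterateInv_inr_lift (s : A ⊗[C] B) :
    mulIterateInv R hij h (AlgCoprod.inr C R E (Algebra.TensorProduct.lift i j hij s)) =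
      Algebra.TensorProduct.map (AlgHom.id C B) (AlgCoprod.inr C (RootAlgebra C B R) A)
        (Algebra.TensorProduct.comm C A B s) := by
  simp [mulIterateInv]

theorem mulIterateInv_inr_left (a : A) :
    mulIterateInv R hij h (AlgCoprod.inr C R E (i a)) = 1 ⊗ₜ AlgCoprod.inr C _ A a := by
  simpa using mulIterateInv_inr_lift (R := R) hij h (a ⊗ₜ 1)

theorem mulIterateInv_inr_right (b : B) :
    mulIterateInv R hij h (AlgCoprod.inr C R E (j b)) = b ⊗ₜ 1 := by
  simpa using mulIterateInv_inr_lift (R := R) hij h (1 ⊗ₜ b)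

theorem mulIterateInv_map (t : AlgCoprod C R B) :
    mulIterateInv R hij h (AlgCoprod.map (AlgHom.id C R) j t) =
      Algebra.TensorProduct.map (AlgHom.id C B) (AlgCoprod.inl C (RootAlgebra C B R) A)
        ((mulEquiv C B R).symm t) := by
  have comp_eq : (mulIterateInv R hij h).comp (AlgCoprod.map (AlgHom.id C R) j) =
      (Algebra.TensorProduct.map (AlgHom.id C B) (AlgCoprod.inl C (RootAlgebra C B R) A)).comp
        (mulEquiv C B R).symm.toAlgHom :=
    AlgCoprod.hom_ext (by simp [mulIterateInv, unit]) (by simp [mulIterateInv_inr_right])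
  exact DFunLike.congr_fun comp_eq t

theorem mulIterateInv_iterateMap (w : AlgCoprod C (RootAlgebra C B R) A) :
    mulIterateInv R hij h (iterateMap R i j w) = 1 ⊗ₜ w := by
  have comp_eq : (mulIterateInv R hij h).comp (iterateMap R i j) =
      Algebra.TensorProduct.includeRight :=
    AlgCoprod.hom_ext (by simp [mulIterateInv_map]) (by simp [mulIterateInv_inr_left])
  exact DFunLike.congr_fun comp_eq w

theorem mulIterateInv_mulIterateMap (s : B ⊗[C] AlgCoprod C (RootAlgebra C B R) A) :
    mulIterateInv R hij h (mulIterateMap R hij s) = s := by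
  induction s with
  | zero => simp
  | add s s' hs hs' => simp only [_root_.map_add, hs, hs']
  | tmul b w => simp [mulIterateInv_inr_right, mulIterateInv_iterateMap]

include h in
theorem mulIterateMap_bijective : Function.Bijective (mulIterateMap R hij) :=
  Function.bijective_iff_has_inverse.2 ⟨mulIterateInv R hij h, mulIterateInv_mulIterateMap hij h,
    mulIterateMap_mulIterateInv hij h⟩

include h in
theorem iterateMap_injective : Function.Injective (iterateMap R i j) :=
  injective_of_lift_injective (i := (AlgCoprod.inr C R E).comp j) (commute_inr_iterateMap hij)
    (mulIterateMap_bijective hij h).1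

include h in
theorem mem_range_iterateMap_iff {t : AlgCoprod C R E} :
    t ∈ (iterateMap R i j).range ↔ ∀ b, Commute (AlgCoprod.inr C R E (j b)) t := by
  rw [← centralizer_range_eq_range_of_lift_surjective (i := (AlgCoprod.inr C R E).comp j)
    (commute_inr_iterateMap hij) (mulIterateMap_bijective hij h).2, Subalgebra.mem_centralizer_iff]
  exact Set.forall_mem_range

include h in
theorem iterateMap_mem_rootSubalgebra_iff {w : AlgCoprod C (RootAlgebra C B R) A} :
    iterateMap R i j w ∈ rootSubalgebra C E R ↔ w ∈ rootSubalgebra C A (RootAlgebra C B R) := by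
  simp only [mem_rootSubalgebra_iff]
  constructor
  · refine fun hw a => iterateMap_injective hij h ?_
    simpa using (hw (i a)).eq
  · intro hw x
    obtain ⟨s, rfl⟩ := h.2 x
    induction s with
    | zero => simp
    | add s s' hs hs' => simpa only [_root_.map_add] using hs.add_left hs'
    | tmul a b =>
      have commute_left : Commute (AlgCoprod.inr C R E (i a)) (iterateMap R i j w) := by
        simpa using (hw a).map (iterateMap R i j)
      simpa using commute_left.mul_left (commute_inr_iterateMap hij b w)

variable (R) in
/-- The composition of roots: if `A ⊗ B ≃ E`, then the root algebra for `A` of the root algebra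
for `B` of `R` is the root algebra for `E` of `R`. -/
def iterateEquiv : RootAlgebra C A (RootAlgebra C B R) ≃ₐ[C] RootAlgebra C E R :=
  AlgEquiv.ofBijective
    (((iterateMap R i j).comp (rootSubalgebra C A (RootAlgebra C B R)).val).codRestrict
      (rootSubalgebra C E R) fun t => (iterateMap_mem_rootSubalgebra_iff hij h).2 t.2) <| by
    refine ⟨fun s t hst => Subtype.ext (iterateMap_injective hij h (congrArg Subtype.val hst)),
      fun t => ?_⟩
    obtain ⟨w, hw⟩ := (mem_range_iterateMap_iff hij h).2 fun b => commute_inr_coe (j b) t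
    exact ⟨⟨w, (iterateMap_mem_rootSubalgebra_iff hij h).1 (hw.symm ▸ t.2)⟩, Subtype.ext hw⟩

theorem coe_iterateEquiv (t : RootAlgebra C A (RootAlgebra C B R)) :
    (iterateEquiv R hij h t : AlgCoprod C R E) = iterateMap R i j t :=
  rfl

theorem iterateEquiv_map {R' : Type*} [Ring R'] [Algebra C R'] (g : R →ₐ[C] R')
    (t : RootAlgebra C A (RootAlgebra C B R)) :
    iterateEquiv R' hij h (map A (map B g) t) = map E g (iterateEquiv R hij h t) :=
  Subtype.ext (iterateMap_map i j g _)

end Bijective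

end Iterate

end RootAlgebra

section BaseChange

variable {C : Type*} [CommRing C] {R : Type*} [Ring R] [Algebra C R] {A : Type*} [Ring A]
  [Algebra C A] {R' : Type*} [Ring R'] [Algebra C R'] (D : Type*) [CommRing D] [Algebra C D]

namespace AlgCoprod

local instance : Algebra C (AlgCoprod D (D ⊗[C] R) (D ⊗[C] A)) :=
  Algebra.compHom _ (algebraMap C D)

local instance : IsScalarTower C D (AlgCoprod D (D ⊗[C] R) (D ⊗[C] A)) :=
  IsScalarTower.of_algebraMap_eq fun _ => rfl

@[simp]
theorem baseChange_inl (r : R) :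
    baseChange D (inl C R A r) = inl D (D ⊗[C] R) (D ⊗[C] A) (1 ⊗ₜ r) :=
  lift_inl _ _ _

@[simp]
theorem baseChange_inr (a : A) :
    baseChange D (inr C R A a) = inr D (D ⊗[C] R) (D ⊗[C] A) (1 ⊗ₜ a) :=
  lift_inr _ _ _

variable (C R A) in
/-- `AlgCoprod.baseChange` as a homomorphism of `C`-algebras. -/
def baseChangeAlgHom : AlgCoprod C R A →ₐ[C] AlgCoprod D (D ⊗[C] R) (D ⊗[C] A) :=
  lift
    (((inl D (D ⊗[C] R) (D ⊗[C] A)).restrictScalars C).comp Algebra.TensorProduct.includeRight)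
    (((inr D (D ⊗[C] R) (D ⊗[C] A)).restrictScalars C).comp Algebra.TensorProduct.includeRight)

@[simp]
theorem baseChangeAlgHom_apply (t : AlgCoprod C R A) :
    baseChangeAlgHom C R A D t = baseChange D t :=
  rfl

theorem baseChange_map (g : R →ₐ[C] R') (t : AlgCoprod C R A) :
    baseChange D (map g (AlgHom.id C A) t) =
      map (Algebra.TensorProduct.map (AlgHom.id D D) g) (AlgHom.id D (D ⊗[C] A))
        (baseChange D t) := by
  have comp_eq : (baseChangeAlgHom C R' A D).comp (map g (AlgHom.id C A)) =
      ((map (Algebra.TensorProduct.map (AlgHom.id D D) g)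
        (AlgHom.id D (D ⊗[C] A))).restrictScalars C).comp (baseChangeAlgHom C R A D) :=
    hom_ext (by simp) (by simp)
  exact DFunLike.congr_fun comp_eq t

variable (C R A) in
/-- The inverse of the comparison map `D ⊗ (R ∗_C A) → (D ⊗ R) ∗_D (D ⊗ A)`. -/
def baseChangeInv : AlgCoprod D (D ⊗[C] R) (D ⊗[C] A) →ₐ[D] D ⊗[C] AlgCoprod C R A :=
  lift (Algebra.TensorProduct.map (AlgHom.id D D) (inl C R A))
    (Algebra.TensorProduct.map (AlgHom.id D D) (inr C R A))

variable (C R A) in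
/-- The coproduct commutes with base change. -/
def baseChangeEquiv : D ⊗[C] AlgCoprod C R A ≃ₐ[D] AlgCoprod D (D ⊗[C] R) (D ⊗[C] A) :=
  AlgEquiv.ofAlgHom (AlgHom.liftEquiv C D _ _ (baseChangeAlgHom C R A D))
    (baseChangeInv C R A D)
    (by ext <;> simp [baseChangeInv])
    (by ext <;> simp [baseChangeInv])

@[simp]
theorem baseChangeEquiv_tmul (d : D) (t : AlgCoprod C R A) :
    baseChangeEquiv C R A D (d ⊗ₜ t) = d • baseChange D t :=
  AlgHom.liftEquiv_tmul (baseChangeAlgHom C R A D) d t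

end AlgCoprod

namespace RootAlgebra

variable {D} in
theorem mem_rootSubalgebra_tensor_iff {S : Type*} [Ring S] [Algebra D S]
    {t : AlgCoprod D S (D ⊗[C] A)} :
    t ∈ rootSubalgebra D (D ⊗[C] A) S ↔ ∀ a : A, Commute (AlgCoprod.inr D S _ (1 ⊗ₜ a)) t := by
  rw [mem_rootSubalgebra_iff]
  refine ⟨fun h a => h _, fun h x => ?_⟩
  induction x with
  | zero => simp
  | add x y hx hy => simpa only [_root_.map_add] using hx.add_left hy
  | tmul d a => simpa [TensorProduct.tmul_eq_smul_one_tmul d a] using (h a).smul_left d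

variable {D} in
theorem baseChangeEquiv_mem_rootSubalgebra_iff {y : D ⊗[C] AlgCoprod C R A} :
    AlgCoprod.baseChangeEquiv C R A D y ∈ rootSubalgebra D (D ⊗[C] A) (D ⊗[C] R) ↔
      ∀ a, Commute (1 ⊗ₜ AlgCoprod.inr C R A a) y := by
  rw [mem_rootSubalgebra_tensor_iff]
  refine forall_congr' fun a => ?_
  have inr_eq : AlgCoprod.inr D (D ⊗[C] R) (D ⊗[C] A) (1 ⊗ₜ a) =
      AlgCoprod.baseChangeEquiv C R A D (1 ⊗ₜ AlgCoprod.inr C R A a) := by simp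
  rw [inr_eq]
  exact commute_map_iff (AlgCoprod.baseChangeEquiv C R A D).injective

variable (C R A) in
/-- The map `D ⊗ RootAlgebra C A R → D ⊗ (R ∗ A)` induced by the inclusion. -/
def tensorVal : D ⊗[C] RootAlgebra C A R →ₐ[D] D ⊗[C] AlgCoprod C R A :=
  Algebra.TensorProduct.map (AlgHom.id D D) (rootSubalgebra C A R).val

@[simp]
theorem tensorVal_tmul (d : D) (t : RootAlgebra C A R) :
    tensorVal C R A D (d ⊗ₜ t) = d ⊗ₜ (t : AlgCoprod C R A) :=
  rfl

variable (C R A) in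
/-- The map `A → D ⊗ (R ∗ A)`. -/
def tensorInr : A →ₐ[C] D ⊗[C] AlgCoprod C R A :=
  Algebra.TensorProduct.includeRight.comp (AlgCoprod.inr C R A)

@[simp]
theorem tensorInr_apply (a : A) : tensorInr C R A D a = 1 ⊗ₜ AlgCoprod.inr C R A a :=
  rfl

theorem commute_tensorInr_tensorVal (a : A) (s : D ⊗[C] RootAlgebra C A R) :
    Commute (tensorInr C R A D a) ((tensorVal C R A D).restrictScalars C s) := by
  induction s with
  | zero => simp
  | add s s' hs hs' => simpa only [_root_.map_add] using hs.add_right hs'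
  | tmul d t => simp [commute_iff_eq, (commute_inr_coe a t).eq]

variable [IsAzumaya C A]

theorem lift_tensorInr_tensorVal_bijective : Function.Bijective
    (Algebra.TensorProduct.lift (tensorInr C R A D) ((tensorVal C R A D).restrictScalars C)
      (commute_tensorInr_tensorVal D)) := by
  have eq_equiv : Algebra.TensorProduct.lift (tensorInr C R A D)
        ((tensorVal C R A D).restrictScalars C) (commute_tensorInr_tensorVal D) =
      ((Algebra.TensorProduct.leftComm C A D (RootAlgebra C A R)).trans
        (Algebra.TensorProduct.congr AlgEquiv.refl (mulEquiv C A R))).toAlgHom := by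
    refine Algebra.TensorProduct.ext' fun a s => ?_
    induction s with
    | zero => simp
    | add s s' hs hs' => simp only [TensorProduct.tmul_add, _root_.map_add, hs, hs']
    | tmul d t => simp
  rw [eq_equiv]
  exact AlgEquiv.bijective _

theorem tensorVal_injective : Function.Injective (tensorVal C R A D) :=
  injective_of_lift_injective (g := (tensorVal C R A D).restrictScalars C)
    (commute_tensorInr_tensorVal D) (lift_tensorInr_tensorVal_bijective D).1

variable {D} in
theorem mem_range_tensorVal_iff {y : D ⊗[C] AlgCoprod C R A} :
    y ∈ Set.range (tensorVal C R A D) ↔ ∀ a, Commute (tensorInr C R A D a) y := by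
  have range_eq := centralizer_range_eq_range_of_lift_surjective
    (g := (tensorVal C R A D).restrictScalars C)
    (commute_tensorInr_tensorVal D) (lift_tensorInr_tensorVal_bijective D).2
  exact (SetLike.ext_iff.1 range_eq y).symm.trans
    ((Subalgebra.mem_centralizer_iff C).trans Set.forall_mem_range)

variable (C R A) in
/-- The root algebra of an Azumaya algebra commutes with base change. -/
def baseChangeEquiv : D ⊗[C] RootAlgebra C A R ≃ₐ[D] RootAlgebra D (D ⊗[C] A) (D ⊗[C] R) :=
  AlgEquiv.ofBijective
    (((AlgCoprod.baseChangeEquiv C R A D).toAlgHom.comp (tensorVal C R A D)).codRestrict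
      (rootSubalgebra D (D ⊗[C] A) (D ⊗[C] R)) fun s =>
        baseChangeEquiv_mem_rootSubalgebra_iff.2 fun a => commute_tensorInr_tensorVal D a s)
    (by
      refine ⟨fun s t h => tensorVal_injective D <|
        (AlgCoprod.baseChangeEquiv C R A D).injective (congrArg Subtype.val h), ?_⟩
      rintro ⟨x, hx⟩
      obtain ⟨y, rfl⟩ := (AlgCoprod.baseChangeEquiv C R A D).surjective x
      obtain ⟨s, rfl⟩ := mem_range_tensorVal_iff.2 (baseChangeEquiv_mem_rootSubalgebra_iff.1 hx)
      exact ⟨s, rfl⟩)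

@[simp]
theorem coe_baseChangeEquiv_tmul (d : D) (t : RootAlgebra C A R) :
    (baseChangeEquiv C R A D (d ⊗ₜ t) : AlgCoprod D (D ⊗[C] R) (D ⊗[C] A)) =
      d • AlgCoprod.baseChange D (t : AlgCoprod C R A) :=
  AlgCoprod.baseChangeEquiv_tmul D d _

theorem baseChangeEquiv_map (g : R →ₐ[C] R') (t : D ⊗[C] RootAlgebra C A R) :
    baseChangeEquiv C R' A D (Algebra.TensorProduct.map (AlgHom.id D D) (map A g) t) =
      map (D ⊗[C] A) (Algebra.TensorProduct.map (AlgHom.id D D) g)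
        (baseChangeEquiv C R A D t) := by
  induction t with
  | zero => simp
  | add s t hs ht => simp only [_root_.map_add, hs, ht]
  | tmul d t => exact Subtype.ext (by simp [AlgCoprod.baseChange_map])

end RootAlgebra

end BaseChange

section Congr

variable {C : Type*} [CommRing C] {A : Type*} [Ring A] [Algebra C A] {A' : Type*} [Ring A']
  [Algebra C A'] {R : Type*} [Ring R] [Algebra C R] {R' : Type*} [Ring R'] [Algebra C R']

/-- Isomorphic algebras have isomorphic coproducts. -/
def AlgCoprod.congr (ρ : R ≃ₐ[C] R') (α : A ≃ₐ[C] A') : AlgCoprod C R A ≃ₐ[C] AlgCoprod C R' A' :=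
  AlgEquiv.ofAlgHom (map ρ.toAlgHom α.toAlgHom) (map ρ.symm.toAlgHom α.symm.toAlgHom)
    (by ext <;> simp) (by ext <;> simp)

theorem AlgCoprod.congr_inr (ρ : R ≃ₐ[C] R') (α : A ≃ₐ[C] A') (a : A) :
    congr ρ α (inr C R A a) = inr C R' A' (α a) :=
  map_inr _ _ a

namespace RootAlgebra

theorem map_congr_rootSubalgebra (ρ : R ≃ₐ[C] R') (α : A ≃ₐ[C] A') :
    (rootSubalgebra C A R).map (AlgCoprod.congr ρ α : AlgCoprod C R A →ₐ[C] AlgCoprod C R' A') =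
      rootSubalgebra C A' R' := by
  ext y
  obtain ⟨x, rfl⟩ := (AlgCoprod.congr ρ α).surjective y
  refine ((AlgCoprod.congr ρ α).injective.mem_set_image (s := rootSubalgebra C A R)).trans ?_
  rw [SetLike.mem_coe, mem_rootSubalgebra_iff, mem_rootSubalgebra_iff, α.surjective.forall]
  refine forall_congr' fun a => ?_
  rw [← AlgCoprod.congr_inr ρ α]
  exact (commute_map_iff (AlgCoprod.congr ρ α).injective).symm

/-- Isomorphic algebras have isomorphic root algebras. -/
def congr (α : A ≃ₐ[C] A') (ρ : R ≃ₐ[C] R') : RootAlgebra C A R ≃ₐ[C] RootAlgebra C A' R' :=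
  ((AlgCoprod.congr ρ α).subalgebraMap (rootSubalgebra C A R)).trans
    (Subalgebra.equivOfEq _ _ (map_congr_rootSubalgebra ρ α))

end RootAlgebra

end Congr

section Split

/-- Base change of a matrix algebra, as algebras over the new base ring. -/
def tensorMatrixEquiv (k D m : Type*) [CommRing k] [CommRing D] [Algebra k D] [Fintype m]
    [DecidableEq m] : D ⊗[k] Matrix m m k ≃ₐ[D] Matrix m m D :=
  AlgEquiv.ofRingEquiv (f := (matrixEquivTensor m k D).symm.toRingEquiv) fun d => by
    change (matrixEquivTensor m k D).symm (d ⊗ₜ 1) = _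
    ext i j
    simp [matrixEquivTensor_apply_symm, Matrix.algebraMap_matrix_apply, Matrix.one_apply]

variable {k C D : Type*} [CommRing k] [CommRing C] [Algebra k C] [CommRing D] [Algebra C D]
  [Algebra k D] [IsScalarTower k C D] (S : Type*) [Ring S] [Algebra k S]

variable (k C D) in
/-- Cancellation of a base change, for an algebra that need not be commutative. -/
def cancelTensorEquiv : D ⊗[C] (C ⊗[k] S) ≃ₐ[D] D ⊗[k] S :=
  (Algebra.TensorProduct.assoc k C D D C S).symm.trans
    (Algebra.TensorProduct.congr (Algebra.TensorProduct.rid C D D) AlgEquiv.refl)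

@[simp]
theorem cancelTensorEquiv_tmul (d : D) (c : C) (s : S) :
    cancelTensorEquiv k C D S (d ⊗ₜ (c ⊗ₜ s)) = (c • d) ⊗ₜ s := by
  simp [cancelTensorEquiv]

variable {S}

theorem cancelTensorEquiv_one_tmul (x : C ⊗[k] S) :
    cancelTensorEquiv k C D S (1 ⊗ₜ x) =
      Algebra.TensorProduct.map (IsScalarTower.toAlgHom k C D) (AlgHom.id k S) x := by
  induction x with
  | zero => simp
  | add x y hx hy => simp only [TensorProduct.tmul_add, map_add, hx, hy]
  | tmul c s => simp [Algebra.algebraMap_eq_smul_one]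

theorem map_cancelTensorEquiv {E : Type*} [CommRing E] [Algebra C E] [Algebra k E]
    [IsScalarTower k C E] (φ : D →ₐ[C] E) (x : D ⊗[C] (C ⊗[k] S)) :
    Algebra.TensorProduct.map (φ.restrictScalars k) (AlgHom.id k S)
        (cancelTensorEquiv k C D S x) =
      cancelTensorEquiv k C E S (Algebra.TensorProduct.map φ (AlgHom.id C (C ⊗[k] S)) x) := by
  induction x with
  | zero => simp
  | add x y hx hy => simp only [map_add, hx, hy]
  | tmul d y =>
    induction y with
    | zero => simp
    | add x y hx hy => simp only [TensorProduct.tmul_add, map_add, hx, hy]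
    | tmul c s => simp

variable (S) in
/-- If `D` splits `A`, then over `D` the `A`-th root of a constant algebra `C ⊗ S` is the matrix
root of `S`. -/
def RootAlgebra.splitEquiv {A : Type*} [Ring A] [Algebra C A] [IsAzumaya C A]
    {m : Type*} [Fintype m] [DecidableEq m] [Nonempty m] (e : D ⊗[C] A ≃ₐ[D] Matrix m m D) :
    D ⊗[C] RootAlgebra C A (C ⊗[k] S) ≃ₐ[D] D ⊗[C] (C ⊗[k] RootAlgebra k (Matrix m m k) S) :=
  have := IsAzumaya.matrix k m
  (baseChangeEquiv C (C ⊗[k] S) A D).trans <|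
    (congr (e.trans (tensorMatrixEquiv k D m).symm) (cancelTensorEquiv k C D S)).trans <|
    (baseChangeEquiv k S (Matrix m m k) D).symm.trans (cancelTensorEquiv k C D _).symm

end Split

section Density

open Module Polynomial

variable {K : Type*} [Field K]

theorem separable_iff_resultant_derivative_ne_zero {f : K[X]} (hf : f.Monic) :
    f.Separable ↔ resultant f (derivative f) f.natDegree (f.natDegree - 1) ≠ 0 := by
  obtain ⟨k, hk⟩ := Nat.exists_eq_add_of_le (natDegree_derivative_le f)
  rw [hk, resultant_add_right_deg _ _ _ _ k le_rfl, hf.coeff_natDegree, one_pow, one_mul,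
    ← isUnit_iff_ne_zero, isUnit_resultant_iff_isCoprime hf, separable_def]

theorem exists_separable_charpoly [Infinite K] (V : Type*) [AddCommGroup V] [Module K V]
    [FiniteDimensional K V] : ∃ f : End K V, f.charpoly.Separable := by
  let d : Fin (finrank K V) ↪ K := Fin.valEmbedding.trans (Infinite.natEmbedding K)
  refine ⟨Matrix.toLin (finBasis K V) (finBasis K V) (Matrix.diagonal d), ?_⟩
  rw [Matrix.charpoly_toLin, Matrix.charpoly_diagonal]
  exact separable_prod_X_sub_C_iff.2 d.injective

theorem exists_separable_charpoly_of_surjective {T : Set K} (hT : T.Infinite) {V : Type*}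
    [AddCommGroup V] [Module K V] [FiniteDimensional K V] {ι : Type*} [Finite ι]
    {φ : (ι → K) →ₗ[K] End K V} (hφ : Function.Surjective φ) :
    ∃ t, (∀ i, t i ∈ T) ∧ (φ t).charpoly.Separable := by
  classical
  have := Fintype.ofFinite ι
  have : Infinite K := hT.to_subtype.of_injective _ Subtype.val_injective
  let F := φ.polyCharpoly (Pi.basisFun K ι)
  let P := resultant F (derivative F) (finrank K V) (finrank K V - 1)
  have eval_P (t : ι → K) : MvPolynomial.eval t P ≠ 0 ↔ (φ t).charpoly.Separable := by
    have map_F : F.map (MvPolynomial.eval t) = (φ t).charpoly :=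
      φ.polyCharpoly_map_eq_charpoly (Pi.basisFun K ι) t
    rw [separable_iff_resultant_derivative_ne_zero (φ t).charpoly_monic,
      LinearMap.charpoly_natDegree, ← map_F, derivative_map, resultant_map_map]
  have P_ne_zero : P ≠ 0 := by
    obtain ⟨f, hf⟩ := exists_separable_charpoly (K := K) V
    obtain ⟨s, rfl⟩ := hφ f
    intro hP
    exact (eval_P s).2 hf (by rw [hP, map_zero])
  by_contra! hsep
  exact P_ne_zero <| MvPolynomial.funext_set (fun _ => T) (fun _ => hT) fun t ht => by
    rw [map_zero]
    exact not_not.1 fun h => hsep t (fun i => ht i trivial) ((eval_P t).1 h)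

end Density

section EtalePoints

open Polynomial

universe a

variable {C : Type a} [CommRing C] {K : Type*} [Field K] [Algebra C K]

theorem exists_etale_factorization {f : C[X]} (hf : f.Monic) {p q : K[X]} (hp : p.Monic)
    (hq : q.Monic) (h : f.map (algebraMap C K) = p * q) (hpq : IsCoprime p q) :
    ∃ (D : Type a) (_ : CommRing D) (_ : Algebra C D) (_ : Algebra.Etale C D) (γ : D →ₐ[C] K)
      (P Q : D[X]), P * Q = f.map (algebraMap C D) ∧ IsCoprime P Q ∧
        P.map γ.toRingHom = p ∧ Q.map γ.toRingHom = q := by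
  have natDegree_eq : f.natDegree = p.natDegree + q.natDegree := by
    rw [← hp.natDegree_mul hq, ← h, hf.natDegree_map]
  let f' : MonicDegreeEq C f.natDegree := .mk f hf rfl
  let U := UniversalCoprimeFactorizationRing p.natDegree q.natDegree natDegree_eq f'
  let pointsEquiv := UniversalCoprimeFactorizationRing.homEquiv K _ _ natDegree_eq f'
  let universal := UniversalCoprimeFactorizationRing.homEquiv U _ _ natDegree_eq f' (AlgHom.id C U)
  obtain ⟨γ, hγ⟩ := pointsEquiv.surjective ⟨(.mk p hp rfl, .mk q hq rfl), h.symm, hpq⟩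
  refine ⟨U, inferInstance, inferInstance, inferInstance, γ, universal.1.1.1, universal.1.2.1,
    universal.2.1, universal.2.2, ?_, ?_⟩
  · exact (congrArg Subtype.val (UniversalCoprimeFactorizationRing.homEquiv_comp_fst
      _ _ _ natDegree_eq f' (AlgHom.id C U) γ)).symm.trans (congrArg (fun x => x.1.1.1) hγ)
  · exact (congrArg Subtype.val (UniversalCoprimeFactorizationRing.homEquiv_comp_snd
      _ _ _ natDegree_eq f' (AlgHom.id C U) γ)).symm.trans (congrArg (fun x => x.1.2.1) hγ)

theorem exists_etale_mem_range_of_isRoot {f : C[X]} (hf : f.Monic)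
    (hsep : (f.map (algebraMap C K)).Separable) {x : K}
    (hx : (f.map (algebraMap C K)).IsRoot x) :
    ∃ (D : Type a) (_ : CommRing D) (_ : Algebra C D) (_ : Algebra.Etale C D) (γ : D →ₐ[C] K),
      x ∈ γ.range := by
  obtain ⟨q, hq⟩ := dvd_iff_isRoot.2 hx
  have q_monic : q.Monic := (monic_X_sub_C x).of_mul_monic_left (hq ▸ hf.map _)
  obtain ⟨D, _, _, _, γ, P, Q, -, -, hP, -⟩ := exists_etale_factorization hf
    (monic_X_sub_C x) q_monic hq (hq ▸ hsep).isCoprime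
  refine ⟨D, inferInstance, inferInstance, inferInstance, γ, -P.coeff 0, ?_⟩
  have coeff_zero : γ (P.coeff 0) = -x := by
    simpa using congrArg (fun g => g.coeff 0) hP
  simp [coeff_zero]

theorem exists_etale_forall_mem_range [IsAlgClosed K] {ι : Type*} [Finite ι] {t : ι → K}
    (ht : ∀ i, ∃ N : ℕ, (N : K) ≠ 0 ∧ t i ^ N = 1) :
    ∃ (D : Type a) (_ : CommRing D) (_ : Algebra C D) (_ : Algebra.Etale C D) (γ : D →ₐ[C] K),
      ∀ i, t i ∈ γ.range := by
  have := Fintype.ofFinite ι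
  choose N hN htN using ht
  have : NeZero ((∏ i, N i : ℕ) : K) :=
    ⟨by rw [Nat.cast_prod]; exact Finset.prod_ne_zero_iff.2 fun i _ => hN i⟩
  have : NeZero (∏ i, N i) := .of_neZero_natCast K
  obtain ⟨ζ, hζ⟩ := HasEnoughRootsOfUnity.exists_primitiveRoot K (∏ i, N i)
  obtain ⟨D, _, _, _, γ, hD⟩ := exists_etale_mem_range_of_isRoot (C := C) (x := ζ)
    (monic_X_pow_sub_C 1 (NeZero.ne (∏ i, N i)))
    (by simpa using X_pow_sub_one_separable_iff.2 (NeZero.ne ((∏ i, N i : ℕ) : K)))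
    (by simp [hζ.pow_eq_one])
  refine ⟨D, inferInstance, inferInstance, inferInstance, γ, fun i => ?_⟩
  obtain ⟨M, hM⟩ := Finset.dvd_prod_of_mem N (Finset.mem_univ i)
  obtain ⟨k, -, hk⟩ := hζ.eq_pow_of_pow_eq_one (ξ := t i) (by rw [hM, pow_mul, htN, one_pow])
  exact hk ▸ pow_mem hD k

theorem infinite_setOf_pow_eq_one (K : Type*) [Field K] [IsAlgClosed K] :
    {t : K | ∃ N : ℕ, (N : K) ≠ 0 ∧ t ^ N = 1}.Infinite := by
  have infinite_orders : {N : ℕ | (N : K) ≠ 0}.Infinite := by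
    refine Set.infinite_of_forall_exists_gt fun N => ?_
    by_cases hN : ((N + 1 : ℕ) : K) = 0
    · exact ⟨N + 1 + 1, by simp [Nat.cast_succ (N + 1), hN], by omega⟩
    · exact ⟨N + 1, hN, by omega⟩
  have exists_primitiveRoot (N : ℕ) (hN : (N : K) ≠ 0) : ∃ ζ : K, IsPrimitiveRoot ζ N := by
    have : NeZero (N : K) := ⟨hN⟩
    have : NeZero N := .of_neZero_natCast K
    exact HasEnoughRootsOfUnity.exists_primitiveRoot K N
  choose! ζ hζ using exists_primitiveRoot
  refine Set.infinite_of_injOn_mapsTo (f := ζ) (fun M hM N hN h => ?_)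
    (fun N hN => ⟨N, hN, (hζ N hN).pow_eq_one⟩) infinite_orders
  exact (hζ M hM).unique (h ▸ hζ N hN)

end EtalePoints

section RankOne

open Module Polynomial

variable {K : Type*} [Field K] {V : Type*} [AddCommGroup V] [Module K V] [FiniteDimensional K V]

/- `Y ↦ Y ∘ E` factors through the restriction of `Y` to the range of `E`, so the left ideal
generated by `E` is isomorphic to `Hom (range E) V`. -/
theorem finrank_range_mulRight (E : End K V) :
    finrank K (LinearMap.range (LinearMap.mulRight K E)) =
      finrank K (LinearMap.range E) * finrank K V := by
  let restrict : (LinearMap.range E →ₗ[K] V) →ₗ[K] End K V := LinearMap.lcomp K V E.rangeRestrict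
  have range_eq : LinearMap.range (LinearMap.mulRight K E) = LinearMap.range restrict := by
    apply le_antisymm
    · rintro _ ⟨Y, rfl⟩
      exact ⟨Y ∘ₗ (LinearMap.range E).subtype, rfl⟩
    · rintro _ ⟨g, rfl⟩
      obtain ⟨Y, rfl⟩ := g.exists_extend
      exact ⟨Y, rfl⟩
  have restrict_injective : Function.Injective restrict :=
    LinearMap.lcomp_injective_of_surjective _ E.surjective_rangeRestrict
  rw [range_eq, LinearMap.finrank_range_of_inj restrict_injective, finrank_linearMap]

theorem finrank_range_aeval_eq_one {f : End K V} {l : K} (hl : f.charpoly.rootMultiplicity l = 1)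
    {v : K[X]} (hv : v.eval l ≠ 0) {m : ℕ} (hf : aeval f ((X - C l) ^ m * v) = 0) :
    finrank K (LinearMap.range (aeval f v)) = 1 := by
  have range_le : LinearMap.range (aeval f v) ≤ f.genEigenspace l m := by
    rintro _ ⟨x, rfl⟩
    rw [End.mem_genEigenspace_nat, LinearMap.mem_ker, ← End.mul_apply]
    have aeval_pow : aeval f ((X - C l) ^ m) = (f - l • 1) ^ m := by
      simp [Algebra.algebraMap_eq_smul_one]
    rw [← aeval_pow, ← map_mul, hf, LinearMap.zero_apply]
  refine le_antisymm ?_ ?_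
  · exact (Submodule.finrank_mono range_le).trans
      ((LinearMap.finrank_genEigenspace_le f l m).trans hl.le)
  · have hroot : f.charpoly.IsRoot l :=
      (rootMultiplicity_pos f.charpoly_monic.ne_zero).1 (hl ▸ one_pos)
    obtain ⟨w, hw⟩ := ((End.hasEigenvalue_iff_isRoot_charpoly f l).2 hroot).exists_hasEigenvector
    refine Submodule.one_le_finrank_iff.2 (Submodule.ne_bot_iff _ |>.2 ⟨_, ⟨w, rfl⟩, ?_⟩)
    rw [End.aeval_apply_of_hasEigenvector hw]
    exact smul_ne_zero hv hw.2

end RankOne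

section Idempotent

open Module

variable {D : Type*} [CommRing D] {M : Type*} [AddCommGroup M] [Module D M] {p : End D M}

theorem rangeRestrict_comp_subtype_of_isIdempotentElem (hp : IsIdempotentElem p) :
    p.rangeRestrict ∘ₗ (LinearMap.range p).subtype = LinearMap.id := by
  ext ⟨_, x, rfl⟩
  exact LinearMap.congr_fun hp.eq x

theorem projective_range_of_isIdempotentElem [Projective D M] (hp : IsIdempotentElem p) :
    Projective D (LinearMap.range p) :=
  .of_split _ _ (rangeRestrict_comp_subtype_of_isIdempotentElem hp)

theorem finrank_tensor_range (hp : IsIdempotentElem p) (K : Type*) [Field K] [Algebra D K] :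
    finrank K (K ⊗[D] LinearMap.range p) = finrank K (LinearMap.range (p.baseChange K)) := by
  let ι := (LinearMap.range p).subtype.baseChange K
  let π := p.rangeRestrict.baseChange K
  have π_comp_ι : π ∘ₗ ι = LinearMap.id := by
    rw [← LinearMap.baseChange_comp, rangeRestrict_comp_subtype_of_isIdempotentElem hp,
      LinearMap.baseChange_id]
  have ι_comp_π : ι ∘ₗ π = p.baseChange K := by
    rw [← LinearMap.baseChange_comp]; rfl
  have π_surjective : Function.Surjective π :=
    Function.RightInverse.surjective (LinearMap.congr_fun π_comp_ι)
  rw [← ι_comp_π, LinearMap.range_comp_of_range_eq_top _ (LinearMap.range_eq_top.2 π_surjective),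
    LinearMap.finrank_range_of_inj
      (Function.LeftInverse.injective (LinearMap.congr_fun π_comp_ι))]

end Idempotent

section EtaleIdempotent

open Module Polynomial

universe a

variable {C : Type a} [CommRing C] {K : Type*} [Field K] [Algebra C K]

theorem exists_etale_factorization_of_isRoot {f : C[X]} (hf : f.Monic) {l : K}
    (hl : (f.map (algebraMap C K)).IsRoot l) :
    ∃ (D : Type a) (_ : CommRing D) (_ : Algebra C D) (_ : Algebra.Etale C D) (γ : D →ₐ[C] K)
      (P Q : D[X]) (m : ℕ), P * Q = f.map (algebraMap C D) ∧ IsCoprime P Q ∧ m ≠ 0 ∧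
        P.map γ.toRingHom = (X - Polynomial.C l) ^ m := by
  obtain ⟨q, hq, not_dvd⟩ := exists_eq_pow_rootMultiplicity_mul_and_not_dvd
    (f.map (algebraMap C K)) (hf.map _).ne_zero l
  have pow_monic := (monic_X_sub_C l).pow ((f.map (algebraMap C K)).rootMultiplicity l)
  have q_monic : q.Monic := pow_monic.of_mul_monic_left (hq ▸ hf.map _)
  obtain ⟨D, _, _, _, γ, P, Q, hPQ, coprime, hP, -⟩ :=
    exists_etale_factorization hf pow_monic q_monic hq
      ((irreducible_X_sub_C l).coprime_iff_not_dvd.2 not_dvd).pow_left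
  exact ⟨D, inferInstance, inferInstance, inferInstance, γ, P, Q, _, hPQ, coprime,
    ((rootMultiplicity_pos (hf.map _).ne_zero).2 hl).ne', hP⟩

theorem aeval_one_tmul_map {D B : Type*} [CommRing D] [Algebra C D] [Ring B] [Algebra C B]
    (x : B) (f : C[X]) :
    aeval ((1 : D) ⊗ₜ[C] x) (f.map (algebraMap C D)) = 1 ⊗ₜ aeval x f := by
  rw [aeval_map_algebraMap]
  exact aeval_algHom_apply (Algebra.TensorProduct.includeRight : B →ₐ[C] D ⊗[C] B) x f

/- Over an étale algebra, the primary part of a polynomial equation of `x` at the root `l` splits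
off, and the Bézout relation between the two factors yields the idempotent. -/
theorem exists_etale_isIdempotentElem {B : Type*} [Ring B] [Algebra C B] {x : B}
    (hx : IsIntegral C x) {l : K} (hl : (minpoly K ((1 : K) ⊗ₜ[C] x)).IsRoot l) :
    ∃ (D : Type a) (_ : CommRing D) (_ : Algebra C D) (_ : Algebra.Etale C D) (γ : D →ₐ[C] K)
      (ε : D ⊗[C] B) (v : K[X]) (m : ℕ), IsIdempotentElem ε ∧ v.eval l ≠ 0 ∧
        aeval ((1 : K) ⊗ₜ[C] x) ((X - Polynomial.C l) ^ m * v) = 0 ∧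
        Algebra.TensorProduct.map γ (AlgHom.id C B) ε = aeval ((1 : K) ⊗ₜ[C] x) v := by
  obtain ⟨f, hf, hfx⟩ := hx
  rw [← aeval_def] at hfx
  have root : (f.map (algebraMap C K)).IsRoot l :=
    hl.dvd (minpoly.dvd K _ (by rw [aeval_one_tmul_map, hfx, TensorProduct.tmul_zero]))
  obtain ⟨D, _, _, _, γ, P, Q, m, hPQ, ⟨s, t, hst⟩, hm, hP⟩ :=
    exists_etale_factorization_of_isRoot hf root
  have aeval_PQ : aeval ((1 : D) ⊗ₜ[C] x) (P * Q) = 0 := by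
    rw [hPQ, aeval_one_tmul_map, hfx, TensorProduct.tmul_zero]
  have map_aeval (g : D[X]) : Algebra.TensorProduct.map γ (AlgHom.id C B)
      (aeval ((1 : D) ⊗ₜ[C] x) g) = aeval ((1 : K) ⊗ₜ[C] x) (g.map γ.toRingHom) := by
    have := map_aeval_eq_aeval_map (φ := γ.toRingHom)
      (ψ := (Algebra.TensorProduct.map γ (AlgHom.id C B)).toRingHom)
      (by ext; simp [Algebra.TensorProduct.algebraMap_apply]) g ((1 : D) ⊗ₜ[C] x)
    simpa using this
  refine ⟨D, inferInstance, inferInstance, inferInstance, γ, aeval (1 ⊗ₜ x) (t * Q),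
    (t * Q).map γ.toRingHom, m, ?_, ?_, ?_, map_aeval _⟩
  · have mul_self : t * Q * (t * Q) = t * Q - s * t * (P * Q) := by
      linear_combination (t * Q) * hst
    rw [IsIdempotentElem, ← map_mul, mul_self, map_sub, map_mul _ (s * t), aeval_PQ, mul_zero,
      sub_zero]
  · have eval_bezout := congrArg (fun g => (g.map γ.toRingHom).eval l) hst
    simp only [Polynomial.map_add, Polynomial.map_mul, hP, eval_add, eval_mul, eval_pow, eval_sub,
      eval_X, eval_C, sub_self, zero_pow hm, mul_zero, zero_add, Polynomial.map_one, eval_one]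
      at eval_bezout
    rw [Polynomial.map_mul, eval_mul, eval_bezout]
    exact one_ne_zero
  · rw [← hP, ← Polynomial.map_mul, ← map_aeval,
      show P * (t * Q) = t * (P * Q) by ring, map_mul, aeval_PQ, mul_zero, map_zero]

variable [IsAlgClosed K] {A : Type*} [Ring A] [Algebra C A] [Module.Finite C A]
  {V : Type*} [AddCommGroup V] [Module K V] [FiniteDimensional K V]

/- Elements with separable characteristic polynomial are dense, so one has coordinates that are
roots of unity of order prime to the characteristic; such coordinates lift to an étale algebra. -/
theorem exists_etale_separable_charpoly (e : K ⊗[C] A ≃ₐ[K] End K V) :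
    ∃ (D : Type a) (_ : CommRing D) (_ : Algebra C D) (_ : Algebra.Etale C D) (γ : D →ₐ[C] K)
      (x : D ⊗[C] A), (e (Algebra.TensorProduct.map γ (AlgHom.id C A) x)).charpoly.Separable := by
  obtain ⟨r, s, span_s⟩ := Module.Finite.exists_fin (R := C) (M := A)
  let φ : (Fin r → K) →ₗ[K] End K V :=
    e.toLinearMap ∘ₗ Fintype.linearCombination K fun i => (1 : K) ⊗ₜ[C] s i
  have φ_surjective : Function.Surjective φ := by
    refine e.surjective.comp (LinearMap.range_eq_top.1 ?_)
    rw [Fintype.range_linearCombination]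
    have := congrArg (Submodule.baseChange K) span_s
    rwa [Submodule.baseChange_span, ← Set.range_comp, Submodule.baseChange_top] at this
  obtain ⟨t, ht, separable⟩ :=
    exists_separable_charpoly_of_surjective (infinite_setOf_pow_eq_one K) φ_surjective
  obtain ⟨D, _, _, _, γ, hγ⟩ := exists_etale_forall_mem_range (C := C) ht
  choose d hd using hγ
  refine ⟨D, inferInstance, inferInstance, inferInstance, γ, ∑ i, d i ⊗ₜ s i, ?_⟩
  have map_eq : e (Algebra.TensorProduct.map γ (AlgHom.id C A) (∑ i, d i ⊗ₜ s i)) = φ t := by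
    have hd' (i) : γ (d i) = t i := hd i
    simp [φ, Fintype.linearCombination_apply, TensorProduct.smul_tmul', hd']
  rwa [map_eq]

theorem exists_etale_isIdempotentElem_finrank_range_eq_one [Nontrivial V]
    (e : K ⊗[C] A ≃ₐ[K] End K V) :
    ∃ (D : Type a) (_ : CommRing D) (_ : Algebra C D) (_ : Algebra.Etale C D) (γ : D →ₐ[C] K)
      (ε : D ⊗[C] A), IsIdempotentElem ε ∧
        finrank K (LinearMap.range (e (Algebra.TensorProduct.map γ (AlgHom.id C A) ε))) = 1 := by
  obtain ⟨D₀, _, _, _, γ₀, x, separable⟩ := exists_etale_separable_charpoly e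
  let _ : Algebra D₀ K := γ₀.toAlgebra
  have : IsScalarTower C D₀ K := .of_algebraMap_eq fun c => (γ₀.commutes c).symm
  let E : K ⊗[D₀] (D₀ ⊗[C] A) ≃ₐ[K] End K V := (cancelTensorEquiv C D₀ K A).trans e
  have E_x : E (1 ⊗ₜ x) = e (Algebra.TensorProduct.map γ₀ (AlgHom.id C A) x) :=
    congrArg e (cancelTensorEquiv_one_tmul x)
  rw [← E_x] at separable
  obtain ⟨l, hl⟩ := IsAlgClosed.exists_root (E (1 ⊗ₜ x)).charpoly
    (natDegree_pos_iff_degree_pos.1 (LinearMap.charpoly_natDegree (E (1 ⊗ₜ x)) ▸ finrank_pos)).ne'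
  have multiplicity : (E (1 ⊗ₜ x)).charpoly.rootMultiplicity l = 1 :=
    le_antisymm (rootMultiplicity_le_one_of_separable separable l)
      ((rootMultiplicity_pos (LinearMap.charpoly_monic _).ne_zero).2 hl)
  rw [← Module.End.hasEigenvalue_iff_isRoot_charpoly, Module.End.hasEigenvalue_iff_isRoot,
    minpoly.algEquiv_eq] at hl
  obtain ⟨D, _, _, _, γ, ε, v, m, idempotent, hv, aeval_eq_zero, map_ε⟩ :=
    exists_etale_isIdempotentElem (IsIntegral.of_finite D₀ x) hl
  let _ : Algebra C D := Algebra.compHom D (algebraMap C D₀)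
  have : IsScalarTower C D₀ D := .of_algebraMap_eq fun _ => rfl
  have := Algebra.Etale.comp C D₀ D
  refine ⟨D, inferInstance, inferInstance, inferInstance, γ.restrictScalars C,
    cancelTensorEquiv C D₀ D A ε, idempotent.map (cancelTensorEquiv C D₀ D A), ?_⟩
  have E_aeval (g : K[X]) : E (aeval (1 ⊗ₜ x) g) = aeval (E (1 ⊗ₜ x)) g :=
    (aeval_algHom_apply E.toAlgHom _ g).symm
  rw [map_cancelTensorEquiv, map_ε]
  change finrank K (LinearMap.range (E _)) = 1
  rw [E_aeval]
  exact finrank_range_aeval_eq_one multiplicity hv (by rw [← E_aeval, aeval_eq_zero, map_zero])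

end EtaleIdempotent

section LeftIdeal

open Module

variable {D : Type*} [CommRing D] {X : Type*} [Ring X] [Algebra D X]

theorem isIdempotentElem_mulRight {ε : X} (hε : IsIdempotentElem ε) :
    IsIdempotentElem (LinearMap.mulRight D ε) := by
  ext x
  simp [mul_assoc, hε.eq]

theorem baseChange_mulRight (K : Type*) [CommRing K] [Algebra D K] (x : X) :
    (LinearMap.mulRight D x).baseChange K = LinearMap.mulRight K ((1 : K) ⊗ₜ[D] x) := by
  ext y
  simp

theorem finrank_range_mulRight_algEquiv {Y : Type*} [Ring Y] [Algebra D Y] (e : X ≃ₐ[D] Y)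
    (x : X) :
    finrank D (LinearMap.range (LinearMap.mulRight D (e x))) =
      finrank D (LinearMap.range (LinearMap.mulRight D x)) := by
  have comp_eq : LinearMap.mulRight D (e x) ∘ₗ e.toLinearMap =
      e.toLinearMap ∘ₗ LinearMap.mulRight D x := by
    ext y
    simp
  rw [← LinearMap.range_comp_of_range_eq_top _ e.toLinearEquiv.range, comp_eq,
    LinearMap.range_comp]
  exact e.toLinearEquiv.finrank_map_eq _

theorem finrank_tensor_range_mulRight {K : Type*} [Field K] [Algebra D K] {ε : X}
    (hε : IsIdempotentElem ε) {V : Type*} [AddCommGroup V] [Module K V] [FiniteDimensional K V]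
    (e : K ⊗[D] X ≃ₐ[K] End K V) :
    finrank K (K ⊗[D] LinearMap.range (LinearMap.mulRight D ε)) =
      finrank K (LinearMap.range (e (1 ⊗ₜ ε))) * finrank K V := by
  rw [finrank_tensor_range (isIdempotentElem_mulRight hε), baseChange_mulRight,
    ← finrank_range_mulRight_algEquiv e, finrank_range_mulRight]

variable (D) in
/-- The action of an algebra on the left ideal generated by `ε`, this ideal being encoded as the
range of right multiplication by `ε`. -/
def leftIdealAction (ε : X) : X →ₐ[D] End D (LinearMap.range (LinearMap.mulRight D ε)) :=
  Algebra.lsmul D D ((LinearMap.range (LinearMap.toSpanSingleton X X ε)).restrictScalars D)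

end LeftIdeal

section LocalSplitting

open Module

universe a

variable {C : Type a} [CommRing C] {A : Type*} [Ring A] [Algebra C A]
  {K : Type*} [Field K] [Algebra C K]

theorem exists_free_localizationAway_tensor {D : Type*} [CommRing D] (P : Type*) [AddCommGroup P]
    [Module D P] [Module.Finite D P] [Projective D P] (p : Ideal D) [p.IsPrime] :
    ∃ g ∉ p, Free (Localization.Away g) (Localization.Away g ⊗[D] P) := by
  have := finitePresentation_of_projective D P
  have : Free (Localization.AtPrime p) (LocalizedModule p.primeCompl P) :=
    free_of_flat_of_isLocalRing
  obtain ⟨g, hg, _, -⟩ := FinitePresentation.exists_free_localizedModule_powers p.primeCompl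
    (LocalizedModule.mkLinearMap p.primeCompl P) (Localization.AtPrime p)
  exact ⟨g, hg, .of_equiv (LocalizedModule.equivTensorProduct (.powers g) P)⟩

theorem exists_etale_algHom_matrix_of_action {D : Type a} [CommRing D] [Algebra C D]
    [Algebra.Etale C D] (γ : D →ₐ[C] K) {P : Type*} [AddCommGroup P] [Module D P]
    [Module.Finite D P] [Projective D P] (φ : D ⊗[C] A →ₐ[D] End D P) {n : ℕ}
    (hn : letI := γ.toAlgebra; finrank K (K ⊗[D] P) = n) :
    ∃ (D₁ : Type a) (_ : CommRing D₁) (_ : Algebra C D₁) (_ : Algebra.Etale C D₁)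
      (_ : D₁ →ₐ[C] K), Nonempty (A →ₐ[C] Matrix (Fin n) (Fin n) D₁) := by
  have := RingHom.ker_isPrime γ.toRingHom
  obtain ⟨g, hg, _⟩ := exists_free_localizationAway_tensor P (RingHom.ker γ.toRingHom)
  let D₁ := Localization.Away g
  have isUnit_γg : IsUnit (γ g) := isUnit_iff_ne_zero.2 hg
  let γ₁ : D₁ →ₐ[C] K := IsLocalization.Away.liftAlgHom (f := γ) g isUnit_γg
  let _ : Algebra D K := γ.toAlgebra
  let _ : Algebra D₁ K := γ₁.toAlgebra
  have : IsScalarTower D D₁ K :=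
    .of_algebraMap_eq fun d => (IsLocalization.Away.lift_eq g isUnit_γg d).symm
  have : Nontrivial D₁ := γ₁.toRingHom.domain_nontrivial
  have finrank_eq : finrank D₁ (D₁ ⊗[D] P) = n := by
    rw [← finrank_baseChange (R := K), ← hn]
    exact (TensorProduct.AlgebraTensorModule.cancelBaseChange D D₁ K K P).finrank_eq
  let toMatrix : D ⊗[C] A →ₐ[D] Matrix (Fin n) (Fin n) D₁ :=
    ((algEquivMatrix (finBasisOfFinrankEq D₁ _ finrank_eq)).toAlgHom.restrictScalars D).comp
      ((End.baseChangeHom D D₁ P).comp φ)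
  exact ⟨D₁, inferInstance, inferInstance, inferInstance, γ₁,
    ⟨(toMatrix.restrictScalars C).comp Algebra.TensorProduct.includeRight⟩⟩

variable [IsAlgClosed K] [Module.Finite C A] [Projective C A]

/- A minimal left ideal of the fibre is generated by an idempotent of rank one. This idempotent
lifts to an étale neighbourhood, where the left ideal it generates is the standard
representation. -/
theorem exists_etale_algHom_matrix {V : Type*} [AddCommGroup V] [Module K V]
    [FiniteDimensional K V] [Nontrivial V] (e : K ⊗[C] A ≃ₐ[K] End K V) :
    ∃ (D : Type a) (_ : CommRing D) (_ : Algebra C D) (_ : Algebra.Etale C D) (_ : D →ₐ[C] K),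
      Nonempty (A →ₐ[C] Matrix (Fin (finrank K V)) (Fin (finrank K V)) D) := by
  obtain ⟨D, _, _, _, γ, ε, idempotent, rank_one⟩ :=
    exists_etale_isIdempotentElem_finrank_range_eq_one e
  let _ : Algebra D K := γ.toAlgebra
  have : IsScalarTower C D K := .of_algebraMap_eq fun c => (γ.commutes c).symm
  have := projective_range_of_isIdempotentElem (isIdempotentElem_mulRight (D := D) idempotent)
  have one_tmul : cancelTensorEquiv C D K A (1 ⊗ₜ ε) =
      Algebra.TensorProduct.map γ (AlgHom.id C A) ε := cancelTensorEquiv_one_tmul ε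
  have finrank_eq := finrank_tensor_range_mulRight idempotent ((cancelTensorEquiv C D K A).trans e)
  rw [AlgEquiv.trans_apply, one_tmul, rank_one, one_mul] at finrank_eq
  exact exists_etale_algHom_matrix_of_action γ (leftIdealAction D ε) finrank_eq

end LocalSplitting

section Fibre

open Module

variable {C : Type*} [CommRing C] {A : Type*} [Ring A] [Algebra C A]

theorem isSimpleRing_tensor [IsAzumaya C A] (K : Type*) [Field K] [Algebra C K] :
    IsSimpleRing (K ⊗[C] A) := by
  have := faithfullyFlat_of_faithfulSMul C A
  have : Nontrivial (K ⊗[C] A) := inferInstance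
  refine IsSimpleRing.of_eq_bot_or_eq_top fun I => ?_
  rcases subsingleton_or_nontrivial I.ringCon.Quotient with _ | _
  · right
    rw [← I.one_mem_iff, ← I.ker_ringCon_mk', TwoSidedIdeal.mem_ker]
    exact Subsingleton.elim _ _
  · left
    let π : K ⊗[C] A →ₐ[K] I.ringCon.Quotient := { I.ringCon.mk' with commutes' := fun _ => rfl }
    have π_injective : Function.Injective π := by
      have := lift_injective_of_algebraMap_injective
        ((π.restrictScalars C).comp Algebra.TensorProduct.includeRight)
        (FaithfulSMul.algebraMap_injective K I.ringCon.Quotient)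
      rwa [show (π.restrictScalars C).comp Algebra.TensorProduct.includeRight =
        (AlgHom.liftEquiv C K A I.ringCon.Quotient).symm π from rfl, Equiv.apply_symm_apply] at this
    rw [← I.ker_ringCon_mk', TwoSidedIdeal.ker_eq_bot]
    exact π_injective

theorem finrank_tensor_eq_rankAtStalk (M : Type*) [AddCommGroup M] [Module C M] [Module.Finite C M]
    [Module.Flat C M] (K : Type*) [Field K] [Algebra C K] :
    finrank K (K ⊗[C] M) = rankAtStalk M (PrimeSpectrum.comap (algebraMap C K) ⊥) := by
  rw [← rankAtStalk_baseChange, rankAtStalk_eq_finrank_of_free, Pi.natCast_apply, Nat.cast_id]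

theorem nonempty_tensor_algEquiv_matrix [IsAzumaya C A] (K : Type*) [Field K] [IsAlgClosed K]
    [Algebra C K] {n : ℕ} (hn : finrank K (K ⊗[C] A) = n ^ 2) :
    Nonempty (K ⊗[C] A ≃ₐ[K] Matrix (Fin n) (Fin n) K) := by
  have := isSimpleRing_tensor (C := C) (A := A) K
  obtain ⟨m, -, ⟨e⟩⟩ := IsSimpleRing.exists_algEquiv_matrix_of_isAlgClosed K (K ⊗[C] A)
  have finrank_eq := e.toLinearEquiv.finrank_eq
  rw [hn, finrank_matrix, finrank_self, mul_one, Fintype.card_fin, ← sq] at finrank_eq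
  obtain rfl := Nat.pow_left_injective two_ne_zero finrank_eq
  exact ⟨e⟩

end Fibre

section Rank

open Module

theorem surjective_of_forall_residueField {D : Type*} [CommRing D] {M N : Type*} [AddCommGroup M]
    [Module D M] [AddCommGroup N] [Module D N] [Module.Finite D N] (f : M →ₗ[D] N)
    (hf : ∀ q : PrimeSpectrum D, Function.Surjective (f.baseChange q.asIdeal.ResidueField)) :
    Function.Surjective f := by
  rw [← LinearMap.range_eq_top, ← Submodule.Quotient.subsingleton_iff,
    ← Module.support_eq_empty_iff (R := D), Set.eq_empty_iff_forall_notMem]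
  intro q
  rw [Module.mem_support_iff_nontrivial_residueField_tensorProduct, not_nontrivial_iff_subsingleton]
  have comp_surjective := (LinearMap.lTensor_surjective q.asIdeal.ResidueField
    (Submodule.mkQ_surjective (LinearMap.range f))).comp (hf q)
  have comp_eq_zero : (LinearMap.range f).mkQ.baseChange q.asIdeal.ResidueField ∘ₗ
      f.baseChange q.asIdeal.ResidueField = 0 := by
    rw [← LinearMap.baseChange_comp, LinearMap.range_mkQ_comp, LinearMap.baseChange_zero]
  refine subsingleton_of_forall_eq 0 fun y => ?_
  obtain ⟨x, rfl⟩ := comp_surjective y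
  exact LinearMap.congr_fun comp_eq_zero x

variable {C : Type*} [CommRing C] {A : Type*} [Ring A] [Algebra C A] [IsAzumaya C A]

theorem liftEquiv_bijective_of_rankAtStalk_eq {D : Type*} [CommRing D] [Algebra C D] {T : Type*}
    [Ring T] [Algebra C T] [Algebra D T] [IsScalarTower C D T] [Module.Finite D T] [Projective D T]
    [FaithfulSMul D T] (φ : A →ₐ[C] T)
    (h : ∀ q, rankAtStalk (R := D) T q = rankAtStalk A (PrimeSpectrum.comap (algebraMap C D) q)) :
    Function.Bijective (AlgHom.liftEquiv C D A T φ) := by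
  refine ⟨lift_injective_of_algebraMap_injective φ (FaithfulSMul.algebraMap_injective D T),
    surjective_of_forall_residueField (AlgHom.liftEquiv C D A T φ).toLinearMap fun q => ?_⟩
  have := faithfullyFlat_of_faithfulSMul D T
  let κ := q.asIdeal.ResidueField
  let ψ := AlgHom.liftEquiv C κ A (κ ⊗[D] T)
    (((Algebra.TensorProduct.includeRight : T →ₐ[D] κ ⊗[D] T).restrictScalars C).comp φ)
  have ψ_injective : Function.Injective ψ :=
    lift_injective_of_algebraMap_injective _ (FaithfulSMul.algebraMap_injective κ (κ ⊗[D] T))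
  have finrank_eq : finrank κ (κ ⊗[C] A) = finrank κ (κ ⊗[D] T) := by
    rw [finrank_tensor_eq_rankAtStalk, finrank_tensor_eq_rankAtStalk, h]
    rfl
  have ψ_surjective : Function.Surjective ψ :=
    (LinearMap.injective_iff_surjective_of_finrank_eq_finrank (f := ψ.toLinearMap) finrank_eq).1
      ψ_injective
  have baseChange_comp : (AlgHom.liftEquiv C D A T φ).toLinearMap.baseChange κ ∘ₗ
      (TensorProduct.AlgebraTensorModule.cancelBaseChange C D κ κ A).symm.toLinearMap =
        ψ.toLinearMap := by
    ext a
    simp [ψ]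
  intro y
  obtain ⟨x, hx⟩ := ψ_surjective y
  exact ⟨_, (LinearMap.congr_fun baseChange_comp x).trans hx⟩

end Rank

section Splitting

open Module

universe a b

variable {C : Type a} [CommRing C] {A : Type b} [Ring A] [Algebra C A] [IsAzumaya C A]

theorem exists_etale_algHom_matrix_of_rankAtStalk {n : ℕ} (hn : n ≠ 0) {p : PrimeSpectrum C}
    (hp : rankAtStalk A p = n ^ 2) :
    ∃ (D : Type a) (_ : CommRing D) (_ : Algebra C D) (_ : Algebra.Etale C D)
      (_ : A →ₐ[C] Matrix (Fin n) (Fin n) D),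
      p ∈ Set.range (PrimeSpectrum.comap (algebraMap C D)) := by
  let K := AlgebraicClosure p.asIdeal.ResidueField
  have comap_bot : PrimeSpectrum.comap (algebraMap C K) ⊥ = p := by
    ext c
    change algebraMap C K c = 0 ↔ c ∈ p.asIdeal
    rw [IsScalarTower.algebraMap_apply C p.asIdeal.ResidueField K, map_eq_zero,
      Ideal.algebraMap_residueField_eq_zero]
  have finrank_eq : finrank K (K ⊗[C] A) = n ^ 2 := by
    rw [finrank_tensor_eq_rankAtStalk, comap_bot, hp]
  obtain ⟨e⟩ := nonempty_tensor_algEquiv_matrix K finrank_eq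
  have : NeZero n := ⟨hn⟩
  obtain ⟨D, _, _, _, γ, ⟨φ⟩⟩ := exists_etale_algHom_matrix (e.trans Matrix.toLinAlgEquiv')
  rw [finrank_fin_fun] at φ
  refine ⟨D, _, _, ‹_›, φ, PrimeSpectrum.comap γ.toRingHom ⊥, ?_⟩
  rw [← PrimeSpectrum.comap_comp_apply]
  exact (congrArg (PrimeSpectrum.comap · ⊥) γ.comp_algebraMap).trans comap_bot

theorem nonempty_tensor_algEquiv_matrix_of_algHom {n : ℕ} (hn : n ≠ 0)
    (hA : ∀ p : PrimeSpectrum C, rankAtStalk A p = n ^ 2) {D : Type*} [CommRing D] [Algebra C D]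
    (φ : A →ₐ[C] Matrix (Fin n) (Fin n) D) :
    Nonempty (D ⊗[C] A ≃ₐ[D] Matrix (Fin n) (Fin n) D) := by
  have : NeZero n := ⟨hn⟩
  have : FaithfulSMul D (Matrix (Fin n) (Fin n) D) :=
    inferInstanceAs (FaithfulSMul D (Fin n → Fin n → D))
  refine ⟨AlgEquiv.ofBijective _ (liftEquiv_bijective_of_rankAtStalk_eq φ fun q => ?_)⟩
  have := q.nontrivial
  rw [hA, rankAtStalk_eq_finrank_of_free, finrank_matrix]
  simp [sq]

theorem exists_faithfullyFlat_etale_algEquiv_matrix {n : ℕ} (hn : n ≠ 0)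
    (hA : ∀ p : PrimeSpectrum C, rankAtStalk A p = n ^ 2) :
    ∃ (D : Type a) (_ : CommRing D) (_ : Algebra C D), Algebra.Etale C D ∧
      Module.FaithfullyFlat C D ∧ Nonempty (D ⊗[C] A ≃ₐ[D] Matrix (Fin n) (Fin n) D) := by
  choose D _ _ _ φ mem_range using fun p => exists_etale_algHom_matrix_of_rankAtStalk hn (hA p)
  have isOpen_range (p) : IsOpen (Set.range (PrimeSpectrum.comap (algebraMap C (D p)))) :=
    (PrimeSpectrum.isOpenMap_comap_of_hasGoingDown_of_finitePresentation
      (R := C) (S := D p)).isOpen_range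
  obtain ⟨t, cover⟩ := isCompact_univ.elim_finite_subcover _ isOpen_range
    fun p _ => Set.mem_iUnion.2 ⟨p, mem_range p⟩
  refine ⟨∀ p : t, D p, inferInstance, inferInstance, inferInstance, ?_,
    nonempty_tensor_algEquiv_matrix_of_algHom hn hA
      ((Matrix.piAlgEquiv C).symm.toAlgHom.comp (AlgHom.pi fun p : t => φ p))⟩
  refine Module.FaithfullyFlat.of_comap_surjective fun p => ?_
  obtain ⟨q, hq, r, rfl⟩ := Set.mem_iUnion₂.1 (cover (Set.mem_univ p))
  exact ⟨PrimeSpectrum.comap (Pi.evalRingHom (fun p : t => D p) ⟨q, hq⟩) r, rfl⟩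

theorem subsingleton_of_rankAtStalk_eq_zero
    (hA : ∀ p : PrimeSpectrum C, rankAtStalk A p = 0) : Subsingleton C := by
  have : Subsingleton A := (rankAtStalk_eq_zero_iff_subsingleton (R := C)).1 (funext hA)
  exact (FaithfulSMul.algebraMap_injective C A).subsingleton

end Splitting

section Lift

open Algebra.TensorProduct

variable (C : Type*) [CommRing C] (A : Type*) [Ring A] [Algebra C A] (B : Type*) [Ring B]
  [Algebra C B]

variable {A B} in
theorem includeLeft_commute_includeRight (a : A) (b : B) :
    Commute (includeLeft (S := C) a : A ⊗[C] B) (includeRight b : A ⊗[C] B) :=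
  (Commute.one_right _).tmul (Commute.one_left _)

theorem lift_includeLeft_includeRight_bijective :
    Function.Bijective (lift (includeLeft : A →ₐ[C] A ⊗[C] B) includeRight
      (includeLeft_commute_includeRight C)) := by
  rw [lift_includeLeft_includeRight]
  exact Function.bijective_id

theorem lift_includeRight_includeLeft_bijective :
    Function.Bijective (lift (includeRight : B →ₐ[C] A ⊗[C] B) includeLeft
      fun b a => (includeLeft_commute_includeRight C a b).symm) := by
  have lift_eq_comm : lift (includeRight : B →ₐ[C] A ⊗[C] B) includeLeft
      (fun b a => (includeLeft_commute_includeRight C a b).symm) =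
        (Algebra.TensorProduct.comm C B A).toAlgHom := by
    ext <;> simp
  exact lift_eq_comm ▸ (Algebra.TensorProduct.comm C B A).bijective

end Lift

namespace RootAlgebra

universe c a r l

theorem exists_faithfullyFlat_etale_algEquiv (k : Type l) [CommRing k] {C : Type c} [CommRing C]
    [Algebra k C] {A : Type a} [Ring A] [Algebra C A] [IsAzumaya C A] {n : ℕ}
    (hA : ∀ p : PrimeSpectrum C, Module.rankAtStalk A p = n ^ 2) :
    ∃ (D : Type c) (_ : CommRing D) (_ : Algebra C D), Algebra.Etale C D ∧
      Module.FaithfullyFlat C D ∧ ∀ (S : Type r) [Ring S] [Algebra k S],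
        Nonempty (D ⊗[C] RootAlgebra C A (C ⊗[k] S) ≃ₐ[D]
          D ⊗[C] (C ⊗[k] RootAlgebra k (Matrix (Fin n) (Fin n) k) S)) := by
  rcases eq_or_ne n 0 with rfl | hn
  · have : Subsingleton C := subsingleton_of_rankAtStalk_eq_zero hA
    refine ⟨C, inferInstance, inferInstance, inferInstance, inferInstance, fun S _ _ => ?_⟩
    have := Module.subsingleton C (C ⊗[C] RootAlgebra C A (C ⊗[k] S))
    have := Module.subsingleton C
      (C ⊗[C] (C ⊗[k] RootAlgebra k (Matrix (Fin 0) (Fin 0) k) S))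
    exact ⟨AlgEquiv.ofLinearEquiv 0 (Subsingleton.elim _ _) fun _ _ => Subsingleton.elim _ _⟩
  · obtain ⟨D, _, _, etale, faithfullyFlat, ⟨e⟩⟩ :=
      exists_faithfullyFlat_etale_algEquiv_matrix hn hA
    let _ : Algebra k D := Algebra.compHom D (algebraMap k C)
    have : IsScalarTower k C D := .of_algebraMap_eq fun _ => rfl
    have : NeZero n := ⟨hn⟩
    exact ⟨D, _, _, etale, faithfullyFlat, fun S _ _ => ⟨splitEquiv S e⟩⟩

end RootAlgebra

end

theorem mainTheorem10_general (k : Type z) [CommRing k] (C : Type u) [CommRing C] [Algebra k C]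
    (A : Type v) [Ring A] [Algebra C A] [IsAzumaya C A]
    (B : Type w) [Ring B] [Algebra C B] [IsAzumaya C B] :
    (∃ (e : ∀ (R : Type x) [Ring R] [Algebra C R],
          RootAlgebra C A (RootAlgebra C B R) ≃ₐ[C] RootAlgebra C (A ⊗[C] B) R)
        (e' : ∀ (R : Type x) [Ring R] [Algebra C R],
          RootAlgebra C B (RootAlgebra C A R) ≃ₐ[C] RootAlgebra C (A ⊗[C] B) R),
        (∀ (R : Type x) [Ring R] [Algebra C R] (t : RootAlgebra C A (RootAlgebra C B R)),
          (e R t : AlgCoprod C R (A ⊗[C] B)) =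
            RootAlgebra.iterateMap R (Algebra.TensorProduct.includeLeft : A →ₐ[C] A ⊗[C] B)
              (Algebra.TensorProduct.includeRight : B →ₐ[C] A ⊗[C] B) t) ∧
        (∀ (R : Type x) [Ring R] [Algebra C R] (t : RootAlgebra C B (RootAlgebra C A R)),
          (e' R t : AlgCoprod C R (A ⊗[C] B)) =
            RootAlgebra.iterateMap R (Algebra.TensorProduct.includeRight : B →ₐ[C] A ⊗[C] B)
              (Algebra.TensorProduct.includeLeft : A →ₐ[C] A ⊗[C] B) t) ∧
        (∀ (R : Type x) [Ring R] [Algebra C R] (R' : Type x) [Ring R'] [Algebra C R']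
            (g : R →ₐ[C] R') (t : RootAlgebra C A (RootAlgebra C B R)),
          e R' (RootAlgebra.map A (RootAlgebra.map B g) t) =
            RootAlgebra.map (A ⊗[C] B) g (e R t)) ∧
        (∀ (R : Type x) [Ring R] [Algebra C R] (R' : Type x) [Ring R'] [Algebra C R']
            (g : R →ₐ[C] R') (t : RootAlgebra C B (RootAlgebra C A R)),
          e' R' (RootAlgebra.map B (RootAlgebra.map A g) t) =
            RootAlgebra.map (A ⊗[C] B) g (e' R t))) ∧
    (∀ (D : Type y) [CommRing D] [Algebra C D],
      ∃ e : ∀ (R : Type x) [Ring R] [Algebra C R],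
          D ⊗[C] RootAlgebra C A R ≃ₐ[D] RootAlgebra D (D ⊗[C] A) (D ⊗[C] R),
        (∀ (R : Type x) [Ring R] [Algebra C R] (d : D) (t : RootAlgebra C A R),
          (e R (d ⊗ₜ[C] t) : AlgCoprod D (D ⊗[C] R) (D ⊗[C] A)) =
            d • AlgCoprod.baseChange D (t : AlgCoprod C R A)) ∧
        (∀ (R : Type x) [Ring R] [Algebra C R] (R' : Type x) [Ring R'] [Algebra C R']
            (g : R →ₐ[C] R') (t : D ⊗[C] RootAlgebra C A R),
          e R' (Algebra.TensorProduct.map (AlgHom.id D D) (RootAlgebra.map A g) t) =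
            RootAlgebra.map (D ⊗[C] A) (Algebra.TensorProduct.map (AlgHom.id D D) g)
              (e R t))) ∧
    (∀ n : ℕ, (∀ p : PrimeSpectrum C, Module.rankAtStalk (R := C) A p = n ^ 2) →
      ∃ (D : Type u) (_ : CommRing D) (_ : Algebra C D),
        Algebra.Etale C D ∧ Module.FaithfullyFlat C D ∧
        ∀ (S : Type x) [Ring S] [Algebra k S],
          Nonempty (D ⊗[C] RootAlgebra C A (C ⊗[k] S) ≃ₐ[D]
            D ⊗[C] (C ⊗[k] RootAlgebra k (Matrix (Fin n) (Fin n) k) S))) ∧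
    (∀ f : A →ₐ[C] B,
      ∃ ψ : ∀ (R : Type x) [Ring R] [Algebra C R], RootAlgebra C B R →ₐ[C] RootAlgebra C A R,
        (∀ (R : Type x) [Ring R] [Algebra C R], RootAlgebra.IsInducedBy f (ψ R) ∧
          ∀ φ : RootAlgebra C B R →ₐ[C] RootAlgebra C A R,
            RootAlgebra.IsInducedBy f φ → φ = ψ R) ∧
        (∀ (R : Type x) [Ring R] [Algebra C R] (R' : Type x) [Ring R'] [Algebra C R']
            (g : R →ₐ[C] R'),
          (ψ R').comp (RootAlgebra.map B g) = (RootAlgebra.map A g).comp (ψ R))) := by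
  have left_right := lift_includeLeft_includeRight_bijective C A B
  have right_left := lift_includeRight_includeLeft_bijective C A B
  refine ⟨⟨fun R _ _ => RootAlgebra.iterateEquiv R _ left_right,
      fun R _ _ => RootAlgebra.iterateEquiv R _ right_left,
      fun _ _ _ t => RootAlgebra.coe_iterateEquiv _ left_right t,
      fun _ _ _ t => RootAlgebra.coe_iterateEquiv _ right_left t,
      fun _ _ _ _ _ _ g t => RootAlgebra.iterateEquiv_map _ _ g t,
      fun _ _ _ _ _ _ g t => RootAlgebra.iterateEquiv_map _ _ g t⟩,
    fun D _ _ => ⟨fun R _ _ => RootAlgebra.baseChangeEquiv C R A D,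
      fun _ _ _ d t => RootAlgebra.coe_baseChangeEquiv_tmul D d t,
      fun _ _ _ _ _ _ g t => RootAlgebra.baseChangeEquiv_map D g t⟩,
    fun n hA => RootAlgebra.exists_faithfullyFlat_etale_algEquiv k hA,
    fun f => ⟨fun R _ _ => RootAlgebra.induced R f,
      fun _ _ _ => ⟨RootAlgebra.isInducedBy_iff_eq_induced.2 rfl,
        fun _ => RootAlgebra.isInducedBy_iff_eq_induced.1⟩,
      fun _ _ _ _ _ _ g => RootAlgebra.induced_comp_map f g⟩⟩

theorem mainTheorem10 (C : Type u) [CommRing C] [Algebra ℂ C]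
    (A : Type v) [Ring A] [Algebra C A] [IsAzumaya C A]
    (B : Type w) [Ring B] [Algebra C B] [IsAzumaya C B] :
    -- composition of roots
    (∃ (e : ∀ (R : Type x) [Ring R] [Algebra C R],
          RootAlgebra C A (RootAlgebra C B R) ≃ₐ[C] RootAlgebra C (A ⊗[C] B) R)
        (e' : ∀ (R : Type x) [Ring R] [Algebra C R],
          RootAlgebra C B (RootAlgebra C A R) ≃ₐ[C] RootAlgebra C (A ⊗[C] B) R),
        (∀ (R : Type x) [Ring R] [Algebra C R] (t : RootAlgebra C A (RootAlgebra C B R)),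
          (e R t : AlgCoprod C R (A ⊗[C] B)) =
            RootAlgebra.iterateMap R (Algebra.TensorProduct.includeLeft : A →ₐ[C] A ⊗[C] B)
              (Algebra.TensorProduct.includeRight : B →ₐ[C] A ⊗[C] B) t) ∧
        (∀ (R : Type x) [Ring R] [Algebra C R] (t : RootAlgebra C B (RootAlgebra C A R)),
          (e' R t : AlgCoprod C R (A ⊗[C] B)) =
            RootAlgebra.iterateMap R (Algebra.TensorProduct.includeRight : B →ₐ[C] A ⊗[C] B)
              (Algebra.TensorProduct.includeLeft : A →ₐ[C] A ⊗[C] B) t) ∧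
        (∀ (R : Type x) [Ring R] [Algebra C R] (R' : Type x) [Ring R'] [Algebra C R']
            (g : R →ₐ[C] R') (t : RootAlgebra C A (RootAlgebra C B R)),
          e R' (RootAlgebra.map A (RootAlgebra.map B g) t) =
            RootAlgebra.map (A ⊗[C] B) g (e R t)) ∧
        (∀ (R : Type x) [Ring R] [Algebra C R] (R' : Type x) [Ring R'] [Algebra C R']
            (g : R →ₐ[C] R') (t : RootAlgebra C B (RootAlgebra C A R)),
          e' R' (RootAlgebra.map B (RootAlgebra.map A g) t) =
            RootAlgebra.map (A ⊗[C] B) g (e' R t))) ∧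
    -- base change
    (∀ (D : Type y) [CommRing D] [Algebra C D],
      ∃ e : ∀ (R : Type x) [Ring R] [Algebra C R],
          D ⊗[C] RootAlgebra C A R ≃ₐ[D] RootAlgebra D (D ⊗[C] A) (D ⊗[C] R),
        (∀ (R : Type x) [Ring R] [Algebra C R] (d : D) (t : RootAlgebra C A R),
          (e R (d ⊗ₜ[C] t) : AlgCoprod D (D ⊗[C] R) (D ⊗[C] A)) =
            d • AlgCoprod.baseChange D (t : AlgCoprod C R A)) ∧
        (∀ (R : Type x) [Ring R] [Algebra C R] (R' : Type x) [Ring R'] [Algebra C R']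
            (g : R →ₐ[C] R') (t : D ⊗[C] RootAlgebra C A R),
          e R' (Algebra.TensorProduct.map (AlgHom.id D D) (RootAlgebra.map A g) t) =
            RootAlgebra.map (D ⊗[C] A) (Algebra.TensorProduct.map (AlgHom.id D D) g)
              (e R t))) ∧
    -- comparison with the root algebra of degree `n`, étale locally on `C`
    (∀ n : ℕ, (∀ p : PrimeSpectrum C, Module.rankAtStalk (R := C) A p = n ^ 2) →
      ∃ (D : Type u) (_ : CommRing D) (_ : Algebra C D),
        Algebra.Etale C D ∧ Module.FaithfullyFlat C D ∧
        ∀ (S : Type x) [Ring S] [Algebra ℂ S],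
          Nonempty (D ⊗[C] RootAlgebra C A (C ⊗[ℂ] S) ≃ₐ[D]
            D ⊗[C] (C ⊗[ℂ] NthRootAlgebra n S))) ∧
    -- functoriality in the Azumaya algebra
    (∀ f : A →ₐ[C] B,
      ∃ ψ : ∀ (R : Type x) [Ring R] [Algebra C R], RootAlgebra C B R →ₐ[C] RootAlgebra C A R,
        (∀ (R : Type x) [Ring R] [Algebra C R], RootAlgebra.IsInducedBy f (ψ R) ∧
          ∀ φ : RootAlgebra C B R →ₐ[C] RootAlgebra C A R,
            RootAlgebra.IsInducedBy f φ → φ = ψ R) ∧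
        (∀ (R : Type x) [Ring R] [Algebra C R] (R' : Type x) [Ring R'] [Algebra C R']
            (g : R →ₐ[C] R'),
          (ψ R').comp (RootAlgebra.map B g) = (RootAlgebra.map A g).comp (ψ R))) :=
  mainTheorem10_general ℂ C A B
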